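/- Let $k$ be an algebraically closed field of characteristic zero and let $S=k[x_0,x_1,x_2,x_3]$. A rational map $\mathcal F=(f_0:f_1:f_2:f_3):\mathbb P^3_k\dashrightarrow\mathbb P^3_k$ is given by forms $f_i\in S$ of the same degree $d\ge 1$ with $\gcd(f_0,\dots,f_3)=1$; the number $d$ is the degree of $\mathcal F$, the ideal $J=(f_0,f_1,f_2,f_3)\subset S$ is its base ideal, and $\mathcal F$ is a Cremona map if it has an inverse rational map. Fix a point $o\in\mathbb P^3$. Let $\mathrm J_o(2;\mathbb P^3)$ be the set of Cremona maps $\mathcal G$ of $\mathbb P^3$ for which there is a nonempty open set $U\subset\mathbb P^3$ such that $\mathcal G$ is defined on $U$ and restricts to a biregular map from $U$ onto its image and, for every plane $L\ni o$ with $L\cap U\ne\emptyset$, the Zariski closure $\overline{\mathcal G(L\cap U)}$ is a plane containing $o$. Two rational maps $\mathcal F,\mathcal G$ are linearly equivalent if $\mathcal G=\ell_1\circ\mathcal F\circ\ell_2$ for projective linear transformations $\ell_1,\ell_2$ of $\mathbb P^3$. An ideal is unmixed if it equals the intersection of its primary components of minimal codimension. Theorem. Let $\mathcal F$ be a Cremona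 map of $\mathbb P^3$ of degree $d\ge 2$, with base ideal $J$. The following conditions are equivalent: (a) $\mathcal F$ is linearly equivalent to an element of $\mathrm J_o(2;\mathbb P^3)$; (b) $S/J$ has a minimal graded free resolution of the form $$0\to S(-(d+2))\to S(-(d+1))^3\oplus S(-(2d-1))\to S(-d)^4\to S\to S/J\to 0,$$ and, if $d=2$, the ideal $J$ is not unmixed. -/

import Mathlib

open MvPolynomial

noncomputable section

namespace CremonaMaps

section Projective

variable (k : Type*) [Field k] (n : ℕ)

/-- The homogeneous coordinate ring `k[x₀, …, xₙ]` of projective `n`-space. -/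
abbrev CoordRing := MvPolynomial (Fin (n + 1)) k

/-- The set of `k`-points of projective `n`-space. -/
abbrev ProjSpace := Projectivization k (Fin (n + 1) → k)

variable {k n}

/-- The set of points where a form `p` does not vanish (for homogeneous `p` this does not depend
on the chosen homogeneous coordinates). -/
def basicOpen (p : CoordRing k n) : Set (ProjSpace k n) :=
  {x | eval x.rep p ≠ 0}

/-- The Zariski topology on projective space: the sets `basicOpen p`, with `p` a form, are
a basis of it. -/
instance zariskiTopology : TopologicalSpace (ProjSpace k n) :=
  TopologicalSpace.generateFrom
    {U | ∃ (p : CoordRing k n) (e : ℕ), p.IsHomogeneous e ∧ U = basicOpen p}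

/-- The values of a tuple of polynomials at (the chosen homogeneous coordinates of) a point. -/
def evalTuple (f : Fin (n + 1) → CoordRing k n) (x : ProjSpace k n) : Fin (n + 1) → k :=
  fun i => eval x.rep (f i)

/-- A map of sets `ψ`, considered only on `V ⊆ ℙⁿ`, is a regular map from `V` to `ℙⁿ`: locally on
`V` it is given by forms of the same degree without common zeros. -/
def IsRegularMapOn (V : Set (ProjSpace k n)) (ψ : ProjSpace k n → ProjSpace k n) : Prop :=
  ∀ x ∈ V, ∃ W : Set (ProjSpace k n), IsOpen W ∧ x ∈ W ∧
    ∃ (e : ℕ) (g : Fin (n + 1) → CoordRing k n), (∀ i, (g i).IsHomogeneous e) ∧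
      ∀ y ∈ V ∩ W, ∃ h : evalTuple g y ≠ 0, ψ y = Projectivization.mk k (evalTuple g y) h

/-- The set `S_o(m, n)` of `m`-dimensional linear subspaces of `ℙⁿ` that contain the point `o`. -/
def linearSubspacesThrough (o : ProjSpace k n) (m : ℕ) : Set (Set (ProjSpace k n)) :=
  {L | o ∈ L ∧ ∃ W : Submodule k (Fin (n + 1) → k), Module.finrank k W = m + 1 ∧
    L = {x | x.submodule ≤ W}}

end Projective

/-- A rational map `ℙⁿ ⇢ ℙⁿ` without fixed part, given by `n + 1` forms of the same degree
`d ≥ 1` whose greatest common divisor is `1` (in particular, they are not all zero). Two such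
tuples of forms define the same rational map exactly if they are proportional by a nonzero
scalar; all notions below depend only on the rational map. -/
structure RatMap (k : Type*) [Field k] (n : ℕ) where
  degree : ℕ
  form : Fin (n + 1) → CoordRing k n
  one_le_degree : 1 ≤ degree
  isHomogeneous : ∀ i, (form i).IsHomogeneous degree
  no_fixed_part : ∀ p : CoordRing k n, (∀ i, p ∣ form i) → IsUnit p

namespace RatMap

variable {k : Type*} [Field k] {n : ℕ}

/-- The base ideal. -/
def baseIdeal (F : RatMap k n) : Ideal (CoordRing k n) :=
  Ideal.span (Set.range F.form)

/-- `F ∘ G` is (defined and) the identity, as a rational map. -/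
def CompEqId (F G : RatMap k n) : Prop :=
  ∃ h : CoordRing k n, h ≠ 0 ∧ ∀ i, bind₁ G.form (F.form i) = h * X i

/-- Cremona maps: rational maps of `ℙⁿ` to itself with an inverse rational map. -/
def IsCremona (F : RatMap k n) : Prop :=
  ∃ G : RatMap k n, F.CompEqId G ∧ G.CompEqId F

/-- The open set where `F` is defined. -/
def domain (F : RatMap k n) : Set (ProjSpace k n) :=
  {x | evalTuple F.form x ≠ 0}

/-- The image under `F` of a set of points (points where `F` is not defined are ignored). -/
def image (F : RatMap k n) (A : Set (ProjSpace k n)) : Set (ProjSpace k n) :=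
  {y | ∃ x ∈ A, ∃ h : evalTuple F.form x ≠ 0,
    y = Projectivization.mk k (evalTuple F.form x) h}

/-- `F` restricts to a biregular map from the set `U` onto its image. -/
def IsBiregularOn (F : RatMap k n) (U : Set (ProjSpace k n)) : Prop :=
  U ⊆ F.domain ∧ IsLocallyClosed (F.image U) ∧
    ∃ ψ : ProjSpace k n → ProjSpace k n, IsRegularMapOn (F.image U) ψ ∧
      ∀ x ∈ U, ∀ h : evalTuple F.form x ≠ 0,
        ψ (Projectivization.mk k (evalTuple F.form x) h) = x

/-- Two rational maps are linearly equivalent: `G = ℓ₁ ∘ F ∘ ℓ₂` for projective transformations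
`ℓ₁`, `ℓ₂` (with matrices `A`, `B`; the scalar by which the forms may differ is part of `A`). -/
def LinearlyEquivalent (F G : RatMap k n) : Prop :=
  ∃ A B : GL (Fin (n + 1)) k, ∀ i,
    G.form i = ∑ j, C (A.1 i j) * bind₁ (fun l => ∑ m, C (B.1 l m) * X m) (F.form j)

end RatMap

/-- The de Jonquières group `J_o(m; ℙⁿ)` of type `m` with center `o`, as a set of Cremona maps. -/
def deJonquieres {k : Type*} [Field k] {n : ℕ} (o : ProjSpace k n) (m : ℕ) : Set (RatMap k n) :=
  {F | F.IsCremona ∧ ∃ U : Set (ProjSpace k n), IsOpen U ∧ U.Nonempty ∧ F.IsBiregularOn U ∧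
    ∀ L ∈ linearSubspacesThrough o m, (L ∩ U).Nonempty →
      closure (F.image (L ∩ U)) ∈ linearSubspacesThrough o m}

section Resolution

variable {k : Type*} [Field k] {n : ℕ}

/-- The component of degree `e` of the graded free `S`-module `⨁ᵢ S(-aᵢ)`. -/
def twistedPart {ι : Type*} (a : ι → ℕ) (e : ℕ) : Submodule k (ι → CoordRing k n) :=
  Submodule.pi Set.univ fun i =>
    if a i ≤ e then homogeneousSubmodule (Fin (n + 1)) k (e - a i) else ⊥

/-- The maximal ideal `(x₀, …, xₙ)`. -/
def irrelevantIdeal (k : Type*) [Field k] (n : ℕ) : Ideal (CoordRing k n) :=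
  Ideal.span (Set.range X)

/-- `S/J` has a minimal graded free resolution of the form
`0 → ⨁ᵢ S(-cᵢ) → ⨁ᵢ S(-bᵢ) → ⨁ᵢ S(-aᵢ) → S → S/J → 0`, with all maps homogeneous of
degree `0`. -/
def HasMinimalGradedFreeResolution {ι₁ ι₂ ι₃ : Type*} [Fintype ι₁] [Fintype ι₂] [Fintype ι₃]
    (J : Ideal (CoordRing k n)) (a : ι₁ → ℕ) (b : ι₂ → ℕ) (c : ι₃ → ℕ) : Prop :=
  ∃ (π : (ι₁ → CoordRing k n) →ₗ[CoordRing k n] CoordRing k n)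
    (φ : (ι₂ → CoordRing k n) →ₗ[CoordRing k n] (ι₁ → CoordRing k n))
    (ψ : (ι₃ → CoordRing k n) →ₗ[CoordRing k n] (ι₂ → CoordRing k n)),
    -- the maps are homogeneous of degree `0`
    (∀ e, ∀ v ∈ twistedPart (k := k) a e, (π v).IsHomogeneous e) ∧
    (∀ e, ∀ v ∈ twistedPart (k := k) b e, φ v ∈ twistedPart (k := k) a e) ∧
    (∀ e, ∀ v ∈ twistedPart (k := k) c e, ψ v ∈ twistedPart (k := k) b e) ∧
    -- the sequence is exact
    Function.Injective ψ ∧ Function.Exact ψ φ ∧ Function.Exact φ π ∧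
    Function.Exact π (Submodule.mkQ J) ∧
    -- the resolution is minimal
    LinearMap.range π ≤ irrelevantIdeal k n ∧
    LinearMap.range φ ≤ irrelevantIdeal k n • ⊤ ∧
    LinearMap.range ψ ≤ irrelevantIdeal k n • ⊤

end Resolution

section Unmixed

variable {R : Type*} [CommRing R]

/-- The unmixed part of an ideal: the intersection of its primary components (the members of
a minimal primary decomposition) of minimal codimension. These components belong to minimal primes,
so they are the same in all minimal primary decompositions. -/
def unmixedPart (J : Ideal R) : Ideal R :=
  sInf {Q | ∃ t : Finset (Ideal R), Submodule.IsMinimalPrimaryDecomposition J t ∧ Q ∈ t ∧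
    Q.height = J.height}

/-- An ideal is unmixed if it is equal to its unmixed part. -/
def IsUnmixed (J : Ideal R) : Prop :=
  unmixedPart J = J

end Unmixed

end CremonaMaps

end

/-!
Call a rational map of `ℙ³` *of cone type* if, up to projective transformations of source and
target, it is `(g x₀ : g x₁ : g x₂ : f)` with forms `g`, `f`. For a Cremona map of degree at least
two, both conditions of the theorem are equivalent to being of cone type.

*De Jonquières maps are of cone type.* Let `G` map planes through `o` to planes through `o`, and
let `H` be the inverse of `G`. The equation `l` of a general plane through `o` divides the
pullback `m(G)` of the equation of another such plane (`exists_linForm_dvd_comb`). Substituting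
`H` shows that `l(H)` divides a fixed polynomial times `m`, so up to scalars `l(H)` is one of
finitely many polynomials, or `m` times one of these. As a vector space over an infinite field is
not a finite union of proper subspaces, the same factor `δ` works for all `l`
(`exists_common_factor`): `l(H) = δ · m`, with `m` depending on `l`. Substituting `G` gives `h · l
= δ(G) · m(G)`, so the forms `m(G)` are proportional to the forms `l`
(`isConeType_of_common_factor`).

*Maps of cone type are de Jonquières maps.* After conjugation all planes through `o` are mapped to
themselves; a Cremona map and its inverse restrict to mutually inverse bijections of explicit open
sets, and planes are irreducible (`mem_deJonquieres_of_comb_eq`).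

*The resolution of maps of cone type.* For a Cremona map of this shape `f` has degree at most one
in `x₃` (`degreeOf_last_form_le_one`), hence lies in the ideal `(x₀, x₁, x₂)` if the degree is at
least two. The relations between `g x₀, g x₁, g x₂, f` are then generated by the Koszul relations
and one more (`exact_coneSyz_coneGens`). As `g · (x₀, x₁, x₂)` lies in the base ideal while `g`
does not, there is an embedded component of codimension three (`not_isUnmixed_span_coneGens`).

*From the resolution to the cone type.* The last map of the resolution is a relation `∑ qⱼ cⱼ = 0`
with linear forms `qⱼ`, where by minimality only linear relations `cⱼ` occur
(`exists_linear_syzygies`). Expanding in the variables yields a nonzero skew-symmetric `4 × 4`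
matrix `W` of combinations of the forms of the map with `W x = 0`. If the `qⱼ` are linearly
dependent, then `W` has a constant kernel vector as well, so that up to a change of coordinates it
is the matrix of the cross product with `(g x₀, g x₁, g x₂)` (`isConeType_of_skew`); thus `g x₀, g
x₁, g x₂` belong to the linear system. If they are independent, which is possible only in degree
two, then all four forms occur in `W`. Its Pfaffian vanishes, and since the forms of a Cremona map
are algebraically independent this gives a four-dimensional space of skew-symmetric `4 × 4`
matrices of rank at most two, which does not exist (`exists_sum_smul_eq_zero_of_pf_eq_zero`). The
condition on unmixedness is not needed in this direction.
-/

namespace CremonaMaps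

variable {k : Type*} [Field k] {n : ℕ}

/-! ### Linear substitutions and projective transformations -/

/-- The linear form with a given coefficient vector. -/
noncomputable def linForm : (Fin (n + 1) → k) →ₗ[k] CoordRing k n :=
  Fintype.linearCombination k X

/-- The combination of the forms of a rational map with given constant coefficients. -/
noncomputable def RatMap.comb (F : RatMap k n) : (Fin (n + 1) → k) →ₗ[k] CoordRing k n :=
  Fintype.linearCombination k F.form

lemma linForm_apply (v : Fin (n + 1) → k) : linForm v = ∑ i, C (v i) * X i := by
  simp [linForm, Fintype.linearCombination_apply, smul_eq_C_mul]

lemma RatMap.comb_apply (F : RatMap k n) (v : Fin (n + 1) → k) :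
    F.comb v = ∑ i, C (v i) * F.form i := by
  simp [RatMap.comb, Fintype.linearCombination_apply, smul_eq_C_mul]

lemma linForm_single (i : Fin (n + 1)) : linForm (Pi.single i (1 : k)) = X i := by
  simp [linForm]

lemma linForm_isHomogeneous (v : Fin (n + 1) → k) : (linForm v).IsHomogeneous 1 := by
  rw [linForm_apply]
  exact IsHomogeneous.sum _ _ _ fun i _ => isHomogeneous_C_mul_X _ _

lemma RatMap.comb_isHomogeneous (F : RatMap k n) (v : Fin (n + 1) → k) :
    (F.comb v).IsHomogeneous F.degree := by
  rw [RatMap.comb_apply]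
  exact IsHomogeneous.sum _ _ _ fun i _ => (F.isHomogeneous i).C_mul _

lemma eval_linForm (v x : Fin (n + 1) → k) : eval x (linForm v) = v ⬝ᵥ x := by
  simp [linForm_apply, dotProduct]

lemma linForm_injective : Function.Injective (linForm : (Fin (n + 1) → k) → CoordRing k n) := by
  intro v w h
  ext i
  have := congrArg (eval (Pi.single i (1 : k))) h
  simpa [eval_linForm] using this

/-- The substitution `X l ↦ ∑ m, B l m • X m`. -/
noncomputable def subst (B : Matrix (Fin (n + 1)) (Fin (n + 1)) k) :
    CoordRing k n →ₐ[k] CoordRing k n :=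
  bind₁ fun l => ∑ m, C (B l m) * X m

lemma subst_X (B : Matrix (Fin (n + 1)) (Fin (n + 1)) k) (l : Fin (n + 1)) :
    subst B (X l) = linForm (B l) := by
  simp [subst, linForm_apply]

lemma subst_linForm (B : Matrix (Fin (n + 1)) (Fin (n + 1)) k) (v : Fin (n + 1) → k) :
    subst B (linForm v) = linForm (Matrix.vecMul v B) := by
  simp only [linForm_apply, map_sum, map_mul, subst_X, algHom_C, algebraMap_eq,
    Matrix.vecMul, dotProduct, Finset.mul_sum, Finset.sum_mul]
  rw [Finset.sum_comm]
  simp [mul_assoc]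

lemma subst_subst (B B' : Matrix (Fin (n + 1)) (Fin (n + 1)) k) (p : CoordRing k n) :
    subst B (subst B' p) = subst (B' * B) p := by
  have : (subst B).comp (subst B') = subst (B' * B) := by
    apply algHom_ext
    intro l
    simp only [AlgHom.comp_apply, subst_X, subst_linForm]
    rfl
  exact DFunLike.congr_fun this p

lemma subst_one (p : CoordRing k n) : subst (1 : Matrix (Fin (n + 1)) (Fin (n + 1)) k) p = p := by
  have : subst (1 : Matrix (Fin (n + 1)) (Fin (n + 1)) k) = AlgHom.id k _ := by
    apply algHom_ext
    intro l
    have : (1 : Matrix (Fin (n + 1)) (Fin (n + 1)) k) l = Pi.single l 1 := by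
      ext j; simp [Matrix.one_apply, Pi.single_apply, eq_comm]
    simp [subst_X, this, linForm_single]
  rw [this]; rfl

lemma subst_inv_subst (B : GL (Fin (n + 1)) k) (p : CoordRing k n) :
    subst (B⁻¹).1 (subst B.1 p) = p := by
  rw [subst_subst, ← Units.val_mul, mul_inv_cancel, Units.val_one, subst_one]

lemma subst_subst_inv (B : GL (Fin (n + 1)) k) (p : CoordRing k n) :
    subst B.1 (subst (B⁻¹).1 p) = p := by
  rw [subst_subst, ← Units.val_mul, inv_mul_cancel, Units.val_one, subst_one]

/-- The automorphism of the coordinate ring given by an invertible linear substitution. -/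
noncomputable def substEquiv (B : GL (Fin (n + 1)) k) : CoordRing k n ≃ₐ[k] CoordRing k n :=
  AlgEquiv.ofAlgHom (subst B.1) (subst (B⁻¹).1)
    (AlgHom.ext fun p => subst_subst_inv B p) (AlgHom.ext fun p => subst_inv_subst B p)

@[simp] lemma substEquiv_apply (B : GL (Fin (n + 1)) k) (p : CoordRing k n) :
    substEquiv B p = subst B.1 p := rfl

lemma isHomogeneous_subst {p : CoordRing k n} {e : ℕ} (hp : p.IsHomogeneous e)
    (B : Matrix (Fin (n + 1)) (Fin (n + 1)) k) : (subst B p).IsHomogeneous e := by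
  have := hp.aeval (fun l => ∑ m, C (B l m) * X m) (n := 1)
    (fun i => IsHomogeneous.sum _ _ _ fun i _ => isHomogeneous_C_mul_X _ _)
  rwa [one_mul] at this

/-- Substituting forms of the same degree into a form. -/
lemma isHomogeneous_bind₁ {p : CoordRing k n} {e e' : ℕ} (hp : p.IsHomogeneous e)
    {f : Fin (n + 1) → CoordRing k n} (hf : ∀ i, (f i).IsHomogeneous e') :
    (MvPolynomial.bind₁ f p).IsHomogeneous (e' * e) := hp.aeval f hf

/-- Forms are homogeneous for simultaneous multiplication of the variables by a polynomial. -/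
lemma bind₁_mul_of_isHomogeneous {p : CoordRing k n} {e : ℕ} (hp : p.IsHomogeneous e)
    (h : CoordRing k n) (f : Fin (n + 1) → CoordRing k n) :
    MvPolynomial.bind₁ (fun i => h * f i) p = h ^ e * MvPolynomial.bind₁ f p := by
  conv_lhs => rw [p.as_sum]
  conv_rhs => rw [p.as_sum]
  simp only [map_sum, Finset.mul_sum]
  refine Finset.sum_congr rfl fun m hm => ?_
  have hm' : m.sum (fun _ r => r) = e := by
    have := hp.degree_eq_sum_deg_support hm
    rw [this]; simp [Finsupp.sum]
  rw [bind₁_monomial, bind₁_monomial, ← hm']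
  simp only [mul_pow, Finset.prod_mul_distrib, Finset.prod_pow_eq_pow_sum, Finsupp.sum]
  ring

lemma eval_smul_of_isHomogeneous {p : CoordRing k n} {e : ℕ} (hp : p.IsHomogeneous e)
    (c : k) (v : Fin (n + 1) → k) : eval (c • v) p = c ^ e * eval v p := by
  have := congrArg (eval v) (bind₁_mul_of_isHomogeneous hp (C c) X)
  rw [map_mul, map_pow, eval_C, bind₁_X_left, AlgHom.id_apply] at this
  rw [← this]
  simp only [← coe_aeval_eq_eval, aeval_bind₁, RingHom.coe_coe]
  simp [Pi.smul_def]

lemma eval_bind₁ (f : Fin (n + 1) → CoordRing k n) (v : Fin (n + 1) → k)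
    (p : CoordRing k n) : eval v (bind₁ f p) = eval (fun i => eval v (f i)) p := by
  simp only [← coe_aeval_eq_eval, aeval_bind₁, RingHom.coe_coe]

namespace RatMap

lemma bind₁_linForm (F : RatMap k n) (v : Fin (n + 1) → k) :
    bind₁ F.form (linForm v) = F.comb v := by
  simp [linForm_apply, comb_apply, map_sum]

lemma form_eq_sum_comb (F : RatMap k n) (A : GL (Fin (n + 1)) k) (j : Fin (n + 1)) :
    F.form j = ∑ i, C ((A⁻¹).1 j i) * F.comb (A.1 i) := by
  have h1 : (∑ i, (A⁻¹).1 j i • A.1 i) = Pi.single j 1 := by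
    have : (A⁻¹).1 * A.1 = 1 := by rw [← Units.val_mul, inv_mul_cancel, Units.val_one]
    ext m
    have := congrFun (congrFun this j) m
    simpa [Matrix.mul_apply, Matrix.one_apply, Pi.single_apply, eq_comm] using this
  have h2 := congrArg F.comb h1
  rw [map_sum] at h2
  simp only [map_smul, smul_eq_C_mul] at h2
  rw [h2]
  simp [comb]

lemma isUnit_of_dvd_comb (F : RatMap k n) (A : GL (Fin (n + 1)) k) (p : CoordRing k n)
    (hp : ∀ i, p ∣ F.comb (A.1 i)) : IsUnit p := by
  refine F.no_fixed_part p fun j => ?_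
  rw [F.form_eq_sum_comb A]
  exact Finset.dvd_sum fun i _ => (hp i).mul_left _

lemma comb_mem_baseIdeal (F : RatMap k n) (v : Fin (n + 1) → k) : F.comb v ∈ F.baseIdeal := by
  rw [comb_apply]
  exact Ideal.sum_mem _ fun i _ => Ideal.mul_mem_left _ _ (Ideal.subset_span ⟨i, rfl⟩)

/-- The base ideal is generated by any basis of the linear system. -/
lemma baseIdeal_eq_span_comb (F : RatMap k n) (A : GL (Fin (n + 1)) k) :
    F.baseIdeal = Ideal.span (Set.range fun i => F.comb (A.1 i)) := by
  apply le_antisymm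
  · rw [baseIdeal, Ideal.span_le]
    rintro _ ⟨j, rfl⟩
    rw [F.form_eq_sum_comb A]
    exact Ideal.sum_mem _ fun i _ => Ideal.mul_mem_left _ _ (Ideal.subset_span ⟨i, rfl⟩)
  · rw [Ideal.span_le]
    rintro _ ⟨i, rfl⟩
    exact F.comb_mem_baseIdeal _

/-- The rational map `A ∘ F ∘ B`, for projective transformations `A` and `B`. -/
noncomputable def conj (A B : GL (Fin (n + 1)) k) (F : RatMap k n) : RatMap k n where
  degree := F.degree
  form i := subst B.1 (F.comb (A.1 i))
  one_le_degree := F.one_le_degree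
  isHomogeneous i := isHomogeneous_subst (F.comb_isHomogeneous _) _
  no_fixed_part p hp := by
    have : IsUnit (subst (B⁻¹).1 p) := F.isUnit_of_dvd_comb A _ fun i => by
      have := map_dvd (subst (B⁻¹).1) (hp i)
      rwa [subst_inv_subst] at this
    have := this.map (subst B.1)
    rwa [subst_subst_inv] at this

lemma conj_form (A B : GL (Fin (n + 1)) k) (F : RatMap k n) (i : Fin (n + 1)) :
    (F.conj A B).form i = subst B.1 (F.comb (A.1 i)) := rfl

lemma conj_comb (A B : GL (Fin (n + 1)) k) (F : RatMap k n) (v : Fin (n + 1) → k) :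
    (F.conj A B).comb v = subst B.1 (F.comb (Matrix.vecMul v A.1)) := by
  have : Matrix.vecMul v A.1 = ∑ i, v i • A.1 i := by
    ext m; simp [Matrix.vecMul, dotProduct]
  rw [this, comb_apply, map_sum, map_sum]
  simp [conj_form, smul_eq_C_mul]

lemma bind₁_conj (A B : GL (Fin (n + 1)) k) (F : RatMap k n) (p : CoordRing k n) :
    bind₁ (F.conj A B).form p = subst B.1 (bind₁ F.form (subst A.1 p)) := by
  have : bind₁ (F.conj A B).form = ((subst B.1).comp (bind₁ F.form)).comp (subst A.1) := by
    apply algHom_ext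
    intro i
    simp [conj_form, subst_X, bind₁_linForm]
  rw [this]; rfl

lemma linearlyEquivalent_conj (A B : GL (Fin (n + 1)) k) (F : RatMap k n) :
    F.LinearlyEquivalent (F.conj A B) :=
  ⟨A, B, fun i => by simp [conj_form, comb_apply, map_sum, subst]⟩

lemma LinearlyEquivalent.exists_form_eq {F G : RatMap k n} (h : F.LinearlyEquivalent G) :
    ∃ A B : GL (Fin (n + 1)) k, G.form = (F.conj A B).form := by
  obtain ⟨A, B, h⟩ := h
  exact ⟨A, B, funext fun i => by rw [h i]; simp [conj_form, comb_apply, map_sum, subst]⟩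

lemma conj_conj_form (A B A' B' : GL (Fin (n + 1)) k) (F : RatMap k n) :
    ((F.conj A B).conj A' B').form = (F.conj (A' * A) (B * B')).form := by
  ext1 i
  rw [conj_form, conj_comb, subst_subst, conj_form]
  rfl

lemma CompEqId.bind₁_comb {F G : RatMap k n} {p : CoordRing k n}
    (h : ∀ i, bind₁ G.form (F.form i) = p * X i) (v : Fin (n + 1) → k) :
    bind₁ G.form (F.comb v) = p * linForm v := by
  simp only [comb_apply, linForm_apply, map_sum, map_mul, h, Finset.mul_sum]
  exact Finset.sum_congr rfl fun i _ => by simp; ring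

lemma CompEqId.conj {F G : RatMap k n} (h : F.CompEqId G) (A B : GL (Fin (n + 1)) k) :
    (F.conj A B).CompEqId (G.conj B⁻¹ A⁻¹) := by
  obtain ⟨p, hp, h⟩ := h
  refine ⟨subst (A⁻¹).1 p, ?_, fun i => ?_⟩
  · intro h0
    apply hp
    rw [← subst_subst_inv A p, h0, map_zero]
  · rw [bind₁_conj, conj_form, subst_inv_subst, bind₁_comb h, map_mul, ← subst_X, subst_inv_subst]

lemma IsCremona.conj {F : RatMap k n} (h : F.IsCremona) (A B : GL (Fin (n + 1)) k) :
    (F.conj A B).IsCremona := by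
  obtain ⟨G, h1, h2⟩ := h
  refine ⟨G.conj B⁻¹ A⁻¹, h1.conj A B, ?_⟩
  have := h2.conj B⁻¹ A⁻¹
  rwa [inv_inv, inv_inv] at this

/-- The forms of a dominant rational map satisfy no nontrivial homogeneous relation. -/
lemma CompEqId.eq_zero_of_bind₁_eq_zero {F G : RatMap k n} (h : F.CompEqId G)
    {P : CoordRing k n} {e : ℕ} (hP : P.IsHomogeneous e) (h0 : bind₁ F.form P = 0) : P = 0 := by
  obtain ⟨p, hp, h⟩ := h
  have h1 := congrArg (bind₁ G.form) h0
  rw [bind₁_bind₁, map_zero] at h1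
  simp only [h] at h1
  rw [bind₁_mul_of_isHomogeneous hP, bind₁_X_left, AlgHom.id_apply] at h1
  exact (mul_eq_zero.1 h1).resolve_left (pow_ne_zero _ hp)

lemma CompEqId.comb_injective {F G : RatMap k n} (h : F.CompEqId G) :
    Function.Injective F.comb := by
  rw [injective_iff_map_eq_zero]
  intro v hv
  rw [← bind₁_linForm] at hv
  exact linForm_injective
    ((h.eq_zero_of_bind₁_eq_zero (linForm_isHomogeneous v) hv).trans (map_zero _).symm)

lemma IsCremona.comb_injective {F : RatMap k n} (h : F.IsCremona) :
    Function.Injective F.comb := by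
  obtain ⟨G, h, -⟩ := h
  exact h.comb_injective

end RatMap

/-- Linearly independent vectors, as many as one likes up to the dimension, are the first rows of
an invertible matrix. -/
lemma exists_gl_row_castLE {m : ℕ} (hm : m ≤ n + 1) (v : Fin m → Fin (n + 1) → k)
    (hv : LinearIndependent k v) :
    ∃ A : GL (Fin (n + 1)) k, ∀ i, A.1 (Fin.castLE hm i) = v i := by
  induction hr : n + 1 - m generalizing m with
  | zero =>
    obtain rfl : m = n + 1 := by omega
    have : IsUnit (Matrix.of v) := Matrix.linearIndependent_rows_iff_isUnit.1 hv
    exact ⟨this.unit, fun i => rfl⟩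
  | succ r ih =>
    have hlt : m < n + 1 := by omega
    have : Submodule.span k (Set.range v) ≠ ⊤ := by
      intro h
      have := finrank_span_eq_card hv
      rw [h, finrank_top, Module.finrank_fintype_fun_eq_card, Fintype.card_fin,
        Fintype.card_fin] at this
      omega
    obtain ⟨w, hw⟩ : ∃ w, w ∉ Submodule.span k (Set.range v) := by
      by_contra! h
      exact this (eq_top_iff.2 fun x _ => h x)
    obtain ⟨A, hA⟩ := ih (m := m + 1) hlt (Fin.snoc v w) (hv.finSnoc hw) (by omega)
    refine ⟨A, fun i => ?_⟩
    have := hA i.castSucc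
    rw [Fin.snoc_castSucc] at this
    exact this

lemma exists_gl_row_zero {v : Fin (n + 1) → k} (hv : v ≠ 0) :
    ∃ A : GL (Fin (n + 1)) k, A.1 0 = v := by
  obtain ⟨A, hA⟩ := exists_gl_row_castLE (n := n) (m := 1) (by omega) (fun _ => v)
    (LinearIndependent.of_subsingleton 0 hv)
  exact ⟨A, hA 0⟩

lemma prime_linForm {v : Fin (n + 1) → k} (hv : v ≠ 0) : Prime (linForm v) := by
  obtain ⟨A, hA⟩ := exists_gl_row_zero hv
  have := (MulEquiv.prime_iff (substEquiv A)).2 (X_prime (R := k) (i := (0 : Fin (n + 1))))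
  rwa [substEquiv_apply, subst_X, hA] at this

/-! ### Hyperplanes in the Zariski topology, and divisors of forms -/

lemma isOpen_basicOpen {p : CoordRing k n} {e : ℕ} (hp : p.IsHomogeneous e) :
    IsOpen (basicOpen p) :=
  TopologicalSpace.isOpen_generateFrom_of_mem ⟨p, e, hp, rfl⟩

lemma exists_basicOpen_subset {U : Set (ProjSpace k n)} (hU : IsOpen U) {x : ProjSpace k n}
    (hx : x ∈ U) : ∃ (p : CoordRing k n) (e : ℕ), p.IsHomogeneous e ∧ x ∈ basicOpen p ∧
      basicOpen p ⊆ U := by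
  induction hU with
  | basic s hs =>
    obtain ⟨p, e, hp, rfl⟩ := hs
    exact ⟨p, e, hp, hx, subset_rfl⟩
  | univ => exact ⟨1, 0, isHomogeneous_one _ _, by simp [basicOpen], Set.subset_univ _⟩
  | inter s t _ _ ihs iht =>
    obtain ⟨p, e, hp, hxp, hps⟩ := ihs hx.1
    obtain ⟨q, e', hq, hxq, hqt⟩ := iht hx.2
    have hpq : basicOpen (p * q) = basicOpen p ∩ basicOpen q := by
      ext y; simp [basicOpen, not_or]
    exact ⟨p * q, e + e', hp.mul hq, hpq ▸ ⟨hxp, hxq⟩,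
      hpq ▸ Set.inter_subset_inter hps hqt⟩
  | sUnion S _ ih =>
    obtain ⟨s, hs, hxs⟩ := hx
    obtain ⟨p, e, hp, hxp, hps⟩ := ih s hs hxs
    exact ⟨p, e, hp, hxp, hps.trans (Set.subset_sUnion_of_mem hs)⟩

lemma eval_rep_mk_eq_zero_iff {p : CoordRing k n} {e : ℕ} (hp : p.IsHomogeneous e)
    {v : Fin (n + 1) → k} (hv : v ≠ 0) :
    eval (Projectivization.mk k v hv).rep p = 0 ↔ eval v p = 0 := by
  obtain ⟨a, ha⟩ := Projectivization.exists_smul_eq_mk_rep k v hv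
  rw [← ha, Units.smul_def, eval_smul_of_isHomogeneous hp]
  simp

lemma submodule_le_iff_rep_mem {x : ProjSpace k n} {W : Submodule k (Fin (n + 1) → k)} :
    x.submodule ≤ W ↔ x.rep ∈ W := by
  rw [Projectivization.submodule_eq, Submodule.span_singleton_le_iff_mem]

lemma rep_mk_mem_iff {v : Fin (n + 1) → k} (hv : v ≠ 0) {W : Submodule k (Fin (n + 1) → k)} :
    (Projectivization.mk k v hv).rep ∈ W ↔ v ∈ W := by
  rw [← submodule_le_iff_rep_mem, Projectivization.submodule_mk,
    Submodule.span_singleton_le_iff_mem]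

/-- The hyperplane of vectors on which the linear form with coefficients `v` vanishes. -/
noncomputable def orth (v : Fin (n + 1) → k) : Submodule k (Fin (n + 1) → k) :=
  LinearMap.ker (Fintype.linearCombination k v)

lemma mem_orth {v w : Fin (n + 1) → k} : w ∈ orth v ↔ v ⬝ᵥ w = 0 := by
  simp [orth, Fintype.linearCombination_apply, dotProduct, mul_comm]

lemma mem_orth_comm {v w : Fin (n + 1) → k} : w ∈ orth v ↔ v ∈ orth w := by
  rw [mem_orth, mem_orth, dotProduct_comm]

lemma finrank_orth {v : Fin (n + 1) → k} (hv : v ≠ 0) : Module.finrank k (orth v) = n := by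
  have h1 := LinearMap.finrank_range_add_finrank_ker
    (Fintype.linearCombination k v : (Fin (n + 1) → k) →ₗ[k] k)
  have h2 : LinearMap.range (Fintype.linearCombination k v : (Fin (n + 1) → k) →ₗ[k] k) = ⊤ := by
    rw [LinearMap.range_eq_top]
    apply LinearMap.surjective
    intro h
    apply hv
    ext i
    have := LinearMap.congr_fun h (Pi.single i 1)
    simpa using this
  rw [h2, finrank_top, Module.finrank_self, Module.finrank_fintype_fun_eq_card,
    Fintype.card_fin] at h1
  have : Module.finrank k (orth v) =
    Module.finrank k (LinearMap.ker (Fintype.linearCombination k v : _ →ₗ[k] k)) := rfl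
  omega

/-- Every proper linear subspace lies in a hyperplane. -/
lemma exists_le_orth {W : Submodule k (Fin (n + 1) → k)} (hW : W ≠ ⊤) :
    ∃ v, v ≠ 0 ∧ W ≤ orth v := by
  obtain ⟨f, hf, hWf⟩ := W.exists_le_ker_of_lt_top (lt_top_iff_ne_top.2 hW)
  have key : ∀ w, (fun i => f (Pi.single i 1)) ⬝ᵥ w = f w := by
    intro w
    conv_rhs => rw [pi_eq_sum_univ' w]
    simp [dotProduct, mul_comm]
  refine ⟨fun i => f (Pi.single i 1), fun h => hf ?_, fun w hw => ?_⟩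
  · refine LinearMap.ext fun w => ?_
    have := key w
    rw [h] at this
    simpa using this.symm
  · rw [mem_orth, key]
    exact hWf hw

lemma bind₁_sub_bind₁_mem {I : Ideal (CoordRing k n)} {s t : Fin (n + 1) → CoordRing k n}
    (h : ∀ i, s i - t i ∈ I) (p : CoordRing k n) : bind₁ s p - bind₁ t p ∈ I := by
  have : (Ideal.Quotient.mkₐ k I).comp (bind₁ s) = (Ideal.Quotient.mkₐ k I).comp (bind₁ t) := by
    apply algHom_ext
    intro j
    simp only [AlgHom.comp_apply, bind₁_X_right, Ideal.Quotient.mkₐ_eq_mk]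
    exact Ideal.Quotient.eq.2 (h j)
  exact Ideal.Quotient.eq.1 (DFunLike.congr_fun this p)

lemma sub_bind₁_mem {I : Ideal (CoordRing k n)} {s : Fin (n + 1) → CoordRing k n}
    (h : ∀ i, X i - s i ∈ I) (p : CoordRing k n) : p - bind₁ s p ∈ I := by
  have := bind₁_sub_bind₁_mem h p
  rwa [bind₁_X_left] at this

/-- A polynomial that vanishes on a hyperplane is divisible by the equation of the hyperplane. -/
lemma linForm_dvd_of_eval_eq_zero [Infinite k] {v : Fin (n + 1) → k} (hv : v ≠ 0)
    {p : CoordRing k n} (hp : ∀ w ∈ orth v, eval w p = 0) : linForm v ∣ p := by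
  obtain ⟨i, hi⟩ : ∃ i, v i ≠ 0 := by
    by_contra! h; exact hv (funext h)
  -- the projection onto the hyperplane along the `i`-th coordinate axis
  let s : Fin (n + 1) → CoordRing k n :=
    fun j => X j - C ((Pi.single i (v i)⁻¹ : Fin (n + 1) → k) j) * linForm v
  have h0 : bind₁ s p = 0 := by
    apply MvPolynomial.funext
    intro w
    rw [eval_bind₁, map_zero]
    apply hp
    rw [mem_orth]
    simp only [s, map_sub, map_mul, eval_X, eval_C, eval_linForm, dotProduct, mul_sub,
      Finset.sum_sub_distrib]
    rw [Finset.sum_eq_single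
      (f := fun x => v x * ((Pi.single i (v i)⁻¹ : Fin (n + 1) → k) x * _)) i]
    · simp [hi]
    · intro j _ hj; simp [hj]
    · simp
  have h1 := sub_bind₁_mem (I := Ideal.span {linForm v}) (s := s) (fun j => by
    rw [sub_sub_cancel]
    exact Ideal.mul_mem_left _ _ (Ideal.mem_span_singleton_self _)) p
  rwa [h0, sub_zero, Ideal.mem_span_singleton] at h1

lemma exists_finset_divisors {p : CoordRing k n} (hp : p ≠ 0) :
    ∃ D : Finset (CoordRing k n), ∀ q, q ∣ p → ∃ δ ∈ D, Associated δ q := by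
  classical
  have : Fintype {y : Associates (CoordRing k n) // y ∣ Associates.mk p} :=
    UniqueFactorizationMonoid.fintypeSubtypeDvd _ (Associates.mk_ne_zero.2 hp)
  refine ⟨Finset.univ.image
    fun y : {y : Associates (CoordRing k n) // y ∣ Associates.mk p} => Quot.out y.1,
    fun q hq => ?_⟩
  refine ⟨_, Finset.mem_image_of_mem _ (Finset.mem_univ ⟨Associates.mk q,
    Associates.mk_le_mk_of_dvd hq⟩), ?_⟩
  exact Associates.mk_eq_mk_iff_associated.1 (Associates.quot_out _)

lemma exists_smul_of_associated {p q : CoordRing k n} (h : Associated p q) :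
    ∃ c : k, c • p = q := by
  obtain ⟨u, hu⟩ := h
  obtain ⟨c, -, hc⟩ := MvPolynomial.isUnit_iff_eq_C_of_isReduced.1 u.isUnit
  exact ⟨c, by rw [smul_eq_C_mul, ← hc, mul_comm, hu]⟩

lemma exists_eq_mul_X {a : Fin 3 → CoordRing k n} {x : Fin 3 → Fin (n + 1)}
    (hx : Function.Injective x) (h : ∀ i, X (x 0) * a i = X (x i) * a 0) :
    ∃ g, ∀ i, a i = g * X (x i) := by
  have hd : (X (x 0) : CoordRing k n) ∣ X (x 1) * a 0 := ⟨_, (h 1).symm⟩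
  obtain ⟨g, hg⟩ : (X (x 0) : CoordRing k n) ∣ a 0 := by
    refine (X_prime.dvd_or_dvd hd).resolve_left fun h' => ?_
    rw [X_dvd_X] at h'
    simp [hx.eq_iff] at h'
  refine ⟨g, fun i => ?_⟩
  apply mul_left_cancel₀ (X_ne_zero (R := k) (x 0))
  rw [h i, hg]
  ring

/-! ### De Jonquières maps are of cone type -/

lemma RatMap.eval_comb (F : RatMap k n) (v x : Fin (n + 1) → k) :
    eval x (F.comb v) = v ⬝ᵥ fun i => eval x (F.form i) := by
  simp [comb_apply, dotProduct]

/-- If a rational map `G` sends hyperplanes through `o` to hyperplanes through `o`, then the equation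
of a general hyperplane through `o` divides the pullback of the equation of a hyperplane
through `o`. -/
lemma exists_linForm_dvd_comb [Infinite k] {m : ℕ} {o : ProjSpace k (m + 1)}
    {G : RatMap k (m + 1)} {U : Set (ProjSpace k (m + 1))} (hU : IsOpen U) (hU' : U.Nonempty)
    (h : ∀ L ∈ linearSubspacesThrough o m, (L ∩ U).Nonempty →
      closure (G.image (L ∩ U)) ∈ linearSubspacesThrough o m) :
    ∃ p : CoordRing k (m + 1), p ≠ 0 ∧ ∀ v ∈ orth o.rep, v ≠ 0 → ¬ linForm v ∣ p →
      ∃ μ ∈ orth o.rep, μ ≠ 0 ∧ linForm v ∣ G.comb μ := by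
  obtain ⟨x, hx⟩ := hU'
  obtain ⟨p, e, hp, hxp, hpU⟩ := exists_basicOpen_subset hU hx
  refine ⟨p, ?_, fun v hv hv0 hvp => ?_⟩
  · rintro rfl
    simp [basicOpen] at hxp
  obtain ⟨w, hw, hw0, hwp⟩ : ∃ w ∈ orth v, w ≠ 0 ∧ eval w p ≠ 0 := by
    by_contra! hcon
    refine hvp (linForm_dvd_of_eval_eq_zero hv0 fun w hw => ?_)
    rcases eq_or_ne w 0 with rfl | hw0
    · have hne : orth v ≠ ⊥ := by
        intro h0
        have := finrank_orth hv0
        rw [h0, finrank_bot] at this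
        omega
      obtain ⟨w₀, hw₀, hw₀'⟩ := Submodule.exists_mem_ne_zero_of_ne_bot hne
      have := eval_smul_of_isHomogeneous hp 0 w₀
      rwa [hcon w₀ hw₀ hw₀', mul_zero, zero_smul] at this
    · exact hcon w hw hw0
  have hL : {x : ProjSpace k (m + 1) | x.submodule ≤ orth v} ∈ linearSubspacesThrough o m :=
    ⟨submodule_le_iff_rep_mem.2 (mem_orth_comm.1 hv), orth v, finrank_orth hv0, rfl⟩
  obtain ⟨hoc, W, hW, hcl⟩ := h _ hL ⟨Projectivization.mk k w hw0,
    submodule_le_iff_rep_mem.2 ((rep_mk_mem_iff hw0).2 hw),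
    hpU fun h0 => hwp ((eval_rep_mk_eq_zero_iff hp hw0).1 h0)⟩
  have hWt : W ≠ ⊤ := by
    rintro rfl
    rw [finrank_top, Module.finrank_fintype_fun_eq_card, Fintype.card_fin] at hW
    omega
  obtain ⟨μ, hμ0, hWμ⟩ := exists_le_orth hWt
  refine ⟨μ, ?_, hμ0, ?_⟩
  · rw [hcl] at hoc
    exact mem_orth_comm.1 (hWμ (submodule_le_iff_rep_mem.1 hoc))
  have hdvd : linForm v ∣ p * G.comb μ := by
    refine linForm_dvd_of_eval_eq_zero hv0 fun w hw => ?_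
    rw [map_mul]
    rcases eq_or_ne w 0 with rfl | hw0
    · have := eval_smul_of_isHomogeneous (G.comb_isHomogeneous μ) 0 (0 : Fin (m + 1 + 1) → k)
      rw [smul_zero, zero_pow (by have := G.one_le_degree; omega), zero_mul] at this
      rw [this, mul_zero]
    by_cases hwp : eval w p = 0
    · rw [hwp, zero_mul]
    suffices eval w (G.comb μ) = 0 by rw [this, mul_zero]
    rw [← eval_rep_mk_eq_zero_iff (G.comb_isHomogeneous μ) hw0, RatMap.eval_comb]
    set y := Projectivization.mk k w hw0 with hy
    change μ ⬝ᵥ evalTuple G.form y = 0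
    by_cases hGy : evalTuple G.form y = 0
    · rw [hGy, dotProduct_zero]
    have hmem : Projectivization.mk k _ hGy ∈
        closure (G.image ({x | x.submodule ≤ orth v} ∩ U)) :=
      subset_closure ⟨y, ⟨submodule_le_iff_rep_mem.2 ((rep_mk_mem_iff hw0).2 hw),
        hpU fun h0 => hwp ((eval_rep_mk_eq_zero_iff hp hw0).1 h0)⟩, hGy, rfl⟩
    rw [hcl] at hmem
    have := hWμ ((rep_mk_mem_iff hGy).1 (submodule_le_iff_rep_mem.1 hmem))
    rwa [mem_orth] at this
  exact ((prime_linForm hv0).dvd_or_dvd hdvd).resolve_left hvp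

lemma finrank_le_one_of_comap_span_eq_top {V M : Type*} [AddCommGroup V] [Module k V]
    [AddCommGroup M] [Module k M] {f : V →ₗ[k] M} (hf : Function.Injective f) {x : M}
    (h : (Submodule.span k {x}).comap f = ⊤) : Module.finrank k V ≤ 1 := by
  have hmem : ∀ v, f v ∈ Submodule.span k {x} := fun v => by
    have : v ∈ (⊤ : Submodule k V) := trivial
    rwa [← h] at this
  have h1 := LinearMap.finrank_le_finrank_of_injective (f := f.codRestrict _ hmem)
    (fun a b hab => hf (congrArg Subtype.val hab))
  refine h1.trans ?_
  simpa using finrank_span_le_card (R := k) ({x} : Set M)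

/-- Suppose that for `v ∈ E` the member `H.comb v` of a linear system is a linear form from `E` times
a divisor of a fixed polynomial `q`, except where `v` or `H.comb v` itself gives a divisor of `q`.
Then the divisor can be chosen independently of `v`, because `E` is not a finite union of proper
subspaces, and the subspaces that consist of exceptions have dimension at most one. -/
lemma exists_common_factor [Infinite k] {E : Submodule k (Fin (n + 1) → k)}
    (hE : 2 ≤ Module.finrank k E) {H : RatMap k n} (hH : Function.Injective H.comb)
    {q : CoordRing k n} (hq : q ≠ 0)
    (h : ∀ v ∈ E, linForm v ∣ q ∨ H.comb v ∣ q ∨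
      ∃ δ, δ ∣ q ∧ ∃ μ ∈ E, H.comb v = δ * linForm μ) :
    ∃ δ, ∀ v ∈ E, ∃ μ ∈ E, H.comb v = δ * linForm μ := by
  obtain ⟨D, hD⟩ := exists_finset_divisors hq
  let P₁ : D → Submodule k E := fun δ =>
    (E.map (LinearMap.mulLeft k δ.1 ∘ₗ linForm)).comap (H.comb ∘ₗ E.subtype)
  let P₂ : D → Submodule k E := fun δ =>
    (Submodule.span k {δ.1}).comap (H.comb ∘ₗ E.subtype)
  let P₃ : D → Submodule k E := fun δ =>
    (Submodule.span k {δ.1}).comap (linForm ∘ₗ E.subtype)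
  have hcover : ⋃ i, ((Sum.elim P₁ (Sum.elim P₂ P₃) i : Submodule k E) : Set E) = Set.univ := by
    refine Set.eq_univ_of_forall fun v => Set.mem_iUnion.2 ?_
    rcases h v.1 v.2 with h | h | ⟨δ, hδ, μ, hμ, h⟩
    · obtain ⟨δ, hδ, has⟩ := hD _ h
      obtain ⟨c, hc⟩ := exists_smul_of_associated has
      exact ⟨Sum.inr (Sum.inr ⟨δ, hδ⟩), Submodule.mem_span_singleton.2 ⟨c, hc⟩⟩
    · obtain ⟨δ, hδ, has⟩ := hD _ h
      obtain ⟨c, hc⟩ := exists_smul_of_associated has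
      exact ⟨Sum.inr (Sum.inl ⟨δ, hδ⟩), Submodule.mem_span_singleton.2 ⟨c, hc⟩⟩
    · obtain ⟨δ', hδ', has⟩ := hD _ hδ
      obtain ⟨c, hc⟩ := exists_smul_of_associated has
      refine ⟨Sum.inl ⟨δ', hδ'⟩, c • μ, E.smul_mem _ hμ, ?_⟩
      simp [h, ← hc]
  obtain ⟨i, hi⟩ := Subspace.exists_eq_top_of_iUnion_eq_univ hcover
  have hsub : Function.Injective E.subtype := Subtype.val_injective
  rcases i with δ | δ | δ
  · refine ⟨δ.1, fun v hv => ?_⟩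
    have : (⟨v, hv⟩ : E) ∈ P₁ δ := by
      rw [show P₁ δ = ⊤ from hi]; trivial
    obtain ⟨μ, hμ, h⟩ := this
    exact ⟨μ, hμ, h.symm⟩
  · have := finrank_le_one_of_comap_span_eq_top (hH.comp hsub) (f := H.comb ∘ₗ E.subtype) hi
    omega
  · have := finrank_le_one_of_comap_span_eq_top (linForm_injective.comp hsub)
      (f := linForm ∘ₗ E.subtype) hi
    omega

/-- A rational map of `ℙ³` is of cone type if, up to projective transformations of source and
target, it is of the form `(g x₀ : g x₁ : g x₂ : f)`. -/
def RatMap.IsConeType (F : RatMap k 3) : Prop :=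
  ∃ (A B : GL (Fin 4) k) (g : CoordRing k 3),
    ∀ i : Fin 3, (F.conj A B).form i.castSucc = g * X i.castSucc

lemma exists_linearIndependent_of_finrank_eq {V : Type*} [AddCommGroup V] [Module k V] {m : ℕ}
    [Module.Finite k V] {W : Submodule k V} (hW : Module.finrank k W = m) :
    ∃ v : Fin m → V, LinearIndependent k v ∧ ∀ i, v i ∈ W := by
  let b := Module.finBasisOfFinrankEq k W hW
  have h := b.linearIndependent.map' W.subtype (Submodule.ker_subtype _)
  exact ⟨_, h, fun i => (b i).2⟩

/-- If the pullbacks of the hyperplanes through `o` under the inverse of `G` are, up to a common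
factor, linear forms, then `G` is of cone type. -/
lemma isConeType_of_common_factor {o : ProjSpace k 3} {G H : RatMap k 3} (hHG : H.CompEqId G)
    {δ : CoordRing k 3}
    (hδ : ∀ v ∈ orth o.rep, ∃ μ ∈ orth o.rep, H.comb v = δ * linForm μ) : G.IsConeType := by
  have hH := hHG.comb_injective
  obtain ⟨h, hh, hHG⟩ := hHG
  obtain ⟨v, hv, hvo⟩ := exists_linearIndependent_of_finrank_eq (W := orth o.rep)
    (finrank_orth o.rep_nonzero)
  choose μ _ hμ using fun i => hδ (v i) (hvo i)
  have hμi : LinearIndependent k μ := by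
    rw [Fintype.linearIndependent_iff]
    intro c hc
    refine Fintype.linearIndependent_iff.1 hv c (hH ?_)
    rw [map_sum, map_zero]
    have := congrArg (fun x => δ * linForm x) hc
    simp only [map_sum, map_smul, Finset.mul_sum, mul_smul_comm, map_zero, mul_zero,
      ← hμ] at this
    simpa using this
  obtain ⟨A, hA⟩ := exists_gl_row_castLE (n := 3) (by omega) _ hv
  obtain ⟨M, hM⟩ := exists_gl_row_castLE (n := 3) (by omega) _ hμi
  have hδG : ∀ i, h * linForm (v i) = bind₁ G.form δ * G.comb (μ i) := fun i => by
    rw [← RatMap.CompEqId.bind₁_comb hHG, hμ, map_mul, RatMap.bind₁_linForm]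
  have hδ0 : bind₁ G.form δ ≠ 0 := by
    intro h0
    have := hδG 0
    rw [h0, zero_mul] at this
    exact mul_ne_zero hh (prime_linForm (hv.ne_zero 0)).ne_zero this
  have hsymm : ∀ i, linForm (v 0) * G.comb (μ i) = linForm (v i) * G.comb (μ 0) := by
    intro i
    apply mul_left_cancel₀ (mul_ne_zero hh hδ0)
    linear_combination (bind₁ G.form δ * G.comb (μ i)) * hδG 0 -
      (bind₁ G.form δ * G.comb (μ 0)) * hδG i
  have hX : ∀ i : Fin 3, subst (A⁻¹).1 (linForm (v i)) = X i.castSucc := by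
    intro i
    rw [← hA i, ← subst_X, subst_inv_subst]
    rfl
  obtain ⟨g, hg⟩ := exists_eq_mul_X (a := fun i => subst (A⁻¹).1 (G.comb (μ i)))
    (x := Fin.castSucc) (Fin.castSucc_injective 3) (fun i => by
      rw [← hX, ← hX, ← map_mul, ← map_mul, hsymm])
  refine ⟨M, A⁻¹, g, fun i => ?_⟩
  rw [← hg i, RatMap.conj_form]
  exact congrArg (fun v => subst (A⁻¹).1 (G.comb v)) (hM i)

/-- The pullbacks of the hyperplanes through `o` under the inverse of a de Jonquières map have
a common factor. -/
lemma isConeType_of_mem_deJonquieres [Infinite k] {o : ProjSpace k 3} {G : RatMap k 3}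
    (hG : G ∈ deJonquieres o 2) : G.IsConeType := by
  obtain ⟨⟨H, hGH, hHG⟩, U, hU, hU', -, hL⟩ := hG
  obtain ⟨p, hp, hpG⟩ := exists_linForm_dvd_comb hU hU' hL
  have hH := hHG.comb_injective
  obtain ⟨h', hh', hGH⟩ := hGH
  have ho : 2 ≤ Module.finrank k (orth o.rep) := by rw [finrank_orth o.rep_nonzero]; norm_num
  obtain ⟨δ, hδ⟩ := exists_common_factor ho hH (mul_ne_zero hp hh')
    (fun v hv => by
      rcases eq_or_ne v 0 with rfl | hv0
      · exact Or.inr (Or.inr ⟨1, one_dvd _, 0, zero_mem _, by simp⟩)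
      by_cases hvp : linForm v ∣ p
      · exact Or.inl (hvp.mul_right _)
      refine Or.inr ?_
      obtain ⟨μ, hμ, hμ0, ρ, hρ⟩ := hpG v hv hv0 hvp
      have h1 := congrArg (bind₁ H.form) hρ
      rw [RatMap.CompEqId.bind₁_comb hGH, map_mul, RatMap.bind₁_linForm] at h1
      have h2 : linForm μ ∣ H.comb v * bind₁ H.form ρ := ⟨h', by rw [← h1, mul_comm]⟩
      rcases (prime_linForm hμ0).dvd_or_dvd h2 with ⟨δ, hδ⟩ | ⟨ρ', hρ'⟩
      · refine Or.inr ⟨δ, ?_, μ, hμ, by rw [hδ, mul_comm]⟩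
        refine Dvd.dvd.mul_left ⟨bind₁ H.form ρ, ?_⟩ _
        apply mul_right_cancel₀ (prime_linForm hμ0).ne_zero
        rw [h1, hδ]; ring
      · refine Or.inl (Dvd.dvd.mul_left ⟨ρ', ?_⟩ _)
        apply mul_right_cancel₀ (prime_linForm hμ0).ne_zero
        rw [h1, hρ']; ring)
  exact isConeType_of_common_factor hHG hδ

lemma RatMap.LinearlyEquivalent.isConeType {F G : RatMap k 3} (h : F.LinearlyEquivalent G)
    (hG : G.IsConeType) : F.IsConeType := by
  obtain ⟨A, B, h⟩ := h.exists_form_eq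
  obtain ⟨M, N, g, hg⟩ := hG
  refine ⟨M * A, B * N, g, fun i => ?_⟩
  rw [← hg i, ← RatMap.conj_conj_form, RatMap.conj_form, RatMap.conj_form, RatMap.comb_apply,
    RatMap.comb_apply, h]

/-! ### Cremona maps of cone type are de Jonquières maps -/

/-- Every nonzero vector is the last column of an invertible matrix. -/
lemma exists_gl_mulVec_last {v : Fin (n + 1) → k} (hv : v ≠ 0) :
    ∃ T : GL (Fin (n + 1)) k, T.1.mulVec (Pi.single (Fin.last n) 1) = v := by
  obtain ⟨A, hA⟩ := exists_gl_row_zero hv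
  have h1 : IsUnit (A.1.submatrix (Equiv.swap 0 (Fin.last n)) (Equiv.refl _)).transpose :=
    Matrix.isUnit_transpose _ |>.2 ((Matrix.isUnit_submatrix_equiv _ _).2 A.isUnit)
  refine ⟨h1.unit, ?_⟩
  rw [Matrix.mulVec_single_one]
  ext i
  simp [Matrix.col, hA]

lemma isHomogeneous_of_mul_X {p : CoordRing k n} {i : Fin (n + 1)} {e : ℕ}
    (h : (p * X i).IsHomogeneous e) : p.IsHomogeneous (e - 1) := by
  intro m hm
  have h1 : coeff (m + Finsupp.single i 1) (p * X i) ≠ 0 := by rwa [coeff_mul_X]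
  have h2 := h h1
  rw [map_add, Finsupp.weight_single, Pi.one_apply, smul_eq_mul, mul_one] at h2
  omega

/-- Linear subspaces are irreducible. -/
lemma exists_mem_eval_ne_zero [Infinite k] {W : Submodule k (Fin (n + 1) → k)}
    {x y : Fin (n + 1) → k} (hx : x ∈ W) (hy : y ∈ W) {p q : CoordRing k n}
    (hp : eval x p ≠ 0) (hq : eval y q ≠ 0) : ∃ z ∈ W, eval z p ≠ 0 ∧ eval z q ≠ 0 := by
  -- restriction to the line through `x` and `y`
  let φ : CoordRing k n →ₐ[k] Polynomial k :=
    aeval fun i => Polynomial.C (x i) + Polynomial.X * Polynomial.C (y i - x i)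
  have hφ : ∀ (t : k) (r : CoordRing k n), (φ r).eval t = eval (x + t • (y - x)) r := by
    intro t r
    have : ((Polynomial.aeval t).comp φ) = (aeval (x + t • (y - x)) : CoordRing k n →ₐ[k] k) := by
      apply algHom_ext
      intro i
      simp [φ]
    have := DFunLike.congr_fun this r
    rw [← Polynomial.coe_aeval_eq_eval, ← coe_aeval_eq_eval]
    exact this
  have hφp : φ p ≠ 0 := fun h => hp (by have := hφ 0 p; simpa [h] using this.symm)
  have hφq : φ q ≠ 0 := fun h => hq (by have := hφ 1 q; simpa [h] using this.symm)
  obtain ⟨t, ht⟩ : ∃ t, (φ p * φ q).eval t ≠ 0 := by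
    by_contra! h
    exact mul_ne_zero hφp hφq (Polynomial.funext fun t => by rw [h t, Polynomial.eval_zero])
  rw [Polynomial.eval_mul, hφ, hφ] at ht
  exact ⟨_, W.add_mem hx (W.smul_mem _ (W.sub_mem hy hx)), left_ne_zero_of_mul ht,
    right_ne_zero_of_mul ht⟩

lemma isClosed_setOf_submodule_le_orth (v : Fin (n + 1) → k) :
    IsClosed {x : ProjSpace k n | x.submodule ≤ orth v} := by
  rw [← isOpen_compl_iff]
  convert isOpen_basicOpen (linForm_isHomogeneous v) using 1
  ext x
  simp [basicOpen, submodule_le_iff_rep_mem, mem_orth, eval_linForm]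

lemma closure_inter_basicOpen [Infinite k] {v : Fin (n + 1) → k} {q : CoordRing k n}
    (h : ({x : ProjSpace k n | x.submodule ≤ orth v} ∩ basicOpen q).Nonempty) {e : ℕ}
    (hqe : q.IsHomogeneous e) :
    closure ({x : ProjSpace k n | x.submodule ≤ orth v} ∩ basicOpen q) =
      {x | x.submodule ≤ orth v} := by
  apply Set.Subset.antisymm
  · exact closure_minimal Set.inter_subset_left (isClosed_setOf_submodule_le_orth v)
  intro x hx
  obtain ⟨y, hy, hyq⟩ := h
  rw [mem_closure_iff]
  intro O hO hxO
  obtain ⟨p, e, hp, hxp, hpO⟩ := exists_basicOpen_subset hO hxO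
  obtain ⟨i, hi⟩ : ∃ i, x.rep i ≠ 0 := by
    by_contra! h0; exact x.rep_nonzero (funext h0)
  -- the factor `X i` makes sure that the common point of the two open sets is nonzero
  obtain ⟨z, hz, hzp, hzq⟩ := exists_mem_eval_ne_zero (p := p * X i)
    (submodule_le_iff_rep_mem.1 hx) (submodule_le_iff_rep_mem.1 hy)
    (by rw [map_mul, eval_X]; exact mul_ne_zero hxp hi) hyq
  rw [map_mul, eval_X] at hzp
  have hz0 : z ≠ 0 := fun h0 => right_ne_zero_of_mul hzp (by simp [h0])
  exact ⟨Projectivization.mk k z hz0,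
    hpO fun h0 => left_ne_zero_of_mul hzp ((eval_rep_mk_eq_zero_iff hp hz0).1 h0),
    submodule_le_iff_rep_mem.2 ((rep_mk_mem_iff hz0).2 hz),
    fun h0 => hzq ((eval_rep_mk_eq_zero_iff hqe hz0).1 h0)⟩

lemma RatMap.CompEqId.isHomogeneous {F G : RatMap k n} {p : CoordRing k n}
    (h : ∀ i, bind₁ G.form (F.form i) = p * X i) :
    p.IsHomogeneous (G.degree * F.degree - 1) := by
  apply isHomogeneous_of_mul_X (i := 0)
  rw [← h 0]
  exact isHomogeneous_bind₁ (F.isHomogeneous 0) G.isHomogeneous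

namespace RatMap

lemma mk_eq_mk_of_smul {v w : Fin (n + 1) → k} (hv : v ≠ 0) (hw : w ≠ 0) {c : k}
    (h : v = c • w) : Projectivization.mk k v hv = Projectivization.mk k w hw :=
  (Projectivization.mk_eq_mk_iff' k v w hv hw).2 ⟨c, h.symm⟩

lemma exists_evalTuple_mk (F : RatMap k n) {v : Fin (n + 1) → k} (hv : v ≠ 0) :
    ∃ c : k, c ≠ 0 ∧ evalTuple F.form (Projectivization.mk k v hv) =
      c • fun i => eval v (F.form i) := by
  obtain ⟨a, ha⟩ := Projectivization.exists_smul_eq_mk_rep k v hv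
  refine ⟨(a : k) ^ F.degree, pow_ne_zero _ a.ne_zero, funext fun i => ?_⟩
  rw [evalTuple, ← ha, Units.smul_def, eval_smul_of_isHomogeneous (F.isHomogeneous i)]
  rfl

lemma evalTuple_mk_ne_zero (F : RatMap k n) {v : Fin (n + 1) → k} (hv : v ≠ 0)
    (hF : (fun i => eval v (F.form i)) ≠ 0) :
    evalTuple F.form (Projectivization.mk k v hv) ≠ 0 := by
  obtain ⟨c, hc, h⟩ := F.exists_evalTuple_mk hv
  rw [h]
  exact smul_ne_zero hc hF

lemma mk_evalTuple_mk (F : RatMap k n) {v : Fin (n + 1) → k} (hv : v ≠ 0)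
    (hF : (fun i => eval v (F.form i)) ≠ 0)
    (hF' : evalTuple F.form (Projectivization.mk k v hv) ≠ 0) :
    Projectivization.mk k _ hF' = Projectivization.mk k _ hF := by
  obtain ⟨c, hc, h⟩ := F.exists_evalTuple_mk hv
  exact mk_eq_mk_of_smul _ _ h

lemma eval_form_zero (F : RatMap k n) (i : Fin (n + 1)) : eval 0 (F.form i) = 0 := by
  have h := eval_smul_of_isHomogeneous (F.isHomogeneous i) 0 0
  rwa [smul_zero, zero_pow (by have := F.one_le_degree; omega), zero_mul] at h

/-- The vectors `G(x)` and `H(G(x))`, where `H ∘ G = p · id`. -/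
lemma CompEqId.eval_eval {G H : RatMap k n} {p : CoordRing k n}
    (h : ∀ i, bind₁ G.form (H.form i) = p * X i) (x : Fin (n + 1) → k) :
    (fun i => eval (fun j => eval x (G.form j)) (H.form i)) = eval x p • x := by
  ext i
  have := congrArg (eval x) (h i)
  rw [eval_bind₁, map_mul, eval_X] at this
  exact this

lemma CompEqId.eval_ne_zero {G H : RatMap k n} {p : CoordRing k n}
    (h : ∀ i, bind₁ G.form (H.form i) = p * X i) {x : Fin (n + 1) → k} (hx : x ≠ 0)
    (hp : eval x p ≠ 0) : (fun i => eval x (G.form i)) ≠ 0 := by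
  intro h0
  have h1 := CompEqId.eval_eval h x
  rw [h0] at h1
  have : (fun i => eval (0 : Fin (n + 1) → k) (H.form i)) = 0 := funext H.eval_form_zero
  exact smul_ne_zero hp hx (h1.symm.trans this)

end RatMap

/-- The source of the isomorphism of open sets given by a pair of inverse rational maps `G`, `H` is
cut out by this form: `p` and `q` are the factors in `H ∘ G = p · id` and `G ∘ H = q · id`, and
`g` is a further form. -/
noncomputable def isoLocus (G : RatMap k n) (p q g : CoordRing k n) : CoordRing k n :=
  p * bind₁ G.form q * g

namespace RatMap.CompEqId

variable {G H : RatMap k n} {p q g : CoordRing k n} {a b c : ℕ}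

lemma eval_isoLocus (F : RatMap k n) (x : Fin (n + 1) → k) :
    eval x (isoLocus F p q g) = eval x p * eval (fun i => eval x (F.form i)) q * eval x g := by
  rw [isoLocus, map_mul, map_mul, eval_bind₁]

/-- `G` maps the locus of `isoLocus G p q g` to the locus of the corresponding form for `H`. -/
lemma eval_isoLocus_ne_zero (hHG : ∀ i, bind₁ G.form (H.form i) = p * X i)
    (hp : p.IsHomogeneous a) (hg : g.IsHomogeneous c)
    {x : Fin (n + 1) → k} (hx : eval x (isoLocus G p q g) ≠ 0) :
    eval (fun i => eval x (G.form i)) (isoLocus H q p (bind₁ H.form g)) ≠ 0 := by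
  rw [eval_isoLocus] at hx
  have h1 := left_ne_zero_of_mul (left_ne_zero_of_mul hx)
  rw [eval_isoLocus, eval_bind₁, CompEqId.eval_eval hHG, eval_smul_of_isHomogeneous hp,
    eval_smul_of_isHomogeneous hg]
  exact mul_ne_zero (mul_ne_zero (right_ne_zero_of_mul (left_ne_zero_of_mul hx))
    (mul_ne_zero (pow_ne_zero _ h1) h1)) (mul_ne_zero (pow_ne_zero _ h1)
      (right_ne_zero_of_mul hx))

lemma eval_isoLocus_ne_zero' (hGH : ∀ i, bind₁ H.form (G.form i) = q * X i)
    (hq : q.IsHomogeneous b)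
    {y : Fin (n + 1) → k} (hy : eval y (isoLocus H q p (bind₁ H.form g)) ≠ 0) :
    eval (fun i => eval y (H.form i)) (isoLocus G p q g) ≠ 0 := by
  rw [eval_isoLocus, eval_bind₁] at hy
  have h1 := left_ne_zero_of_mul (left_ne_zero_of_mul hy)
  rw [eval_isoLocus, CompEqId.eval_eval hGH, eval_smul_of_isHomogeneous hq]
  exact mul_ne_zero (mul_ne_zero (right_ne_zero_of_mul (left_ne_zero_of_mul hy))
    (mul_ne_zero (pow_ne_zero _ h1) h1)) (right_ne_zero_of_mul hy)

lemma isHomogeneous_isoLocus (F : RatMap k n) (hp : p.IsHomogeneous a) (hq : q.IsHomogeneous b)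
    (hg : g.IsHomogeneous c) :
    (isoLocus F p q g).IsHomogeneous (a + F.degree * b + c) :=
  (hp.mul (isHomogeneous_bind₁ hq F.isHomogeneous)).mul hg

/-- The image under `G` of a subset of the source of the isomorphism. -/
lemma mem_image_iff (hHG : ∀ i, bind₁ G.form (H.form i) = p * X i)
    (hGH : ∀ i, bind₁ H.form (G.form i) = q * X i)
    (hp : p.IsHomogeneous a) (hq : q.IsHomogeneous b) (hg : g.IsHomogeneous c)
    (A : Set (ProjSpace k n)) (y : ProjSpace k n) :
    y ∈ G.image (A ∩ basicOpen (isoLocus G p q g)) ↔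
      y ∈ basicOpen (isoLocus H q p (bind₁ H.form g)) ∧
        ∃ h : evalTuple H.form y ≠ 0, Projectivization.mk k _ h ∈ A := by
  have hhom := isHomogeneous_isoLocus H hq hp (isHomogeneous_bind₁ hg H.isHomogeneous)
  constructor
  · rintro ⟨x, ⟨hxA, hxU⟩, h0, rfl⟩
    have h1 := hxU
    rw [basicOpen, Set.mem_ofPred, eval_isoLocus] at h1
    have hpx := left_ne_zero_of_mul (left_ne_zero_of_mul h1)
    refine ⟨fun h => eval_isoLocus_ne_zero hHG hp hg hxU
      ((eval_rep_mk_eq_zero_iff hhom h0).1 h), ?_⟩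
    have h2 := CompEqId.eval_eval hHG x.rep
    have h3 : (fun i => eval (evalTuple G.form x) (H.form i)) ≠ 0 :=
      (h2.trans_ne (smul_ne_zero hpx x.rep_nonzero) :)
    have h4 := H.evalTuple_mk_ne_zero h0 h3
    refine ⟨h4, ?_⟩
    rw [H.mk_evalTuple_mk h0 h3, mk_eq_mk_of_smul h3 x.rep_nonzero h2, Projectivization.mk_rep]
    exact hxA
  · rintro ⟨hyV, h0, hA⟩
    have h1 := hyV
    rw [basicOpen, Set.mem_ofPred, eval_isoLocus] at h1
    have hqy := left_ne_zero_of_mul (left_ne_zero_of_mul h1)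
    have h2 := CompEqId.eval_eval hGH y.rep
    have h3 : (fun i => eval (evalTuple H.form y) (G.form i)) ≠ 0 :=
      (h2.trans_ne (smul_ne_zero hqy y.rep_nonzero) :)
    refine ⟨_, ⟨hA, fun h => eval_isoLocus_ne_zero' hGH hq hyV
      ((eval_rep_mk_eq_zero_iff (isHomogeneous_isoLocus G hp hq hg) h0).1 h)⟩,
      G.evalTuple_mk_ne_zero h0 h3, ?_⟩
    rw [G.mk_evalTuple_mk h0 h3, mk_eq_mk_of_smul h3 y.rep_nonzero h2, Projectivization.mk_rep]

lemma isBiregularOn_basicOpen (hHG : ∀ i, bind₁ G.form (H.form i) = p * X i)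
    (hGH : ∀ i, bind₁ H.form (G.form i) = q * X i)
    (hp : p.IsHomogeneous a) (hq : q.IsHomogeneous b) (hg : g.IsHomogeneous c) :
    G.IsBiregularOn (basicOpen (isoLocus G p q g)) := by
  classical
  have hU : ∀ x ∈ basicOpen (isoLocus G p q g), eval x.rep p ≠ 0 := by
    intro x hx
    rw [basicOpen, Set.mem_ofPred, eval_isoLocus] at hx
    exact left_ne_zero_of_mul (left_ne_zero_of_mul hx)
  have hV : ∀ y ∈ G.image (basicOpen (isoLocus G p q g)), evalTuple H.form y ≠ 0 := by
    intro y hy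
    rw [← Set.univ_inter (basicOpen _), mem_image_iff hHG hGH hp hq hg] at hy
    exact hy.2.1
  refine ⟨fun x hx => CompEqId.eval_ne_zero hHG x.rep_nonzero (hU x hx), ?_,
    fun y => if h : evalTuple H.form y ≠ 0 then Projectivization.mk k _ h else y, ?_, ?_⟩
  · have : G.image (basicOpen (isoLocus G p q g)) =
        basicOpen (isoLocus H q p (bind₁ H.form g)) := by
      ext y
      rw [← Set.univ_inter (basicOpen (isoLocus G p q g)), mem_image_iff hHG hGH hp hq hg]
      refine ⟨fun h => h.1, fun h => ⟨h, ?_, trivial⟩⟩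
      rw [basicOpen, Set.mem_ofPred, eval_isoLocus] at h
      exact CompEqId.eval_ne_zero hGH y.rep_nonzero
        (left_ne_zero_of_mul (left_ne_zero_of_mul h))
    rw [this]
    exact (isOpen_basicOpen (isHomogeneous_isoLocus H hq hp
      (isHomogeneous_bind₁ hg H.isHomogeneous))).isLocallyClosed
  · exact fun x _ => ⟨Set.univ, isOpen_univ, trivial, H.degree, H.form, H.isHomogeneous,
      fun y hy => ⟨hV y hy.1, dif_pos (hV y hy.1)⟩⟩
  · intro x hx h0
    have h2 := CompEqId.eval_eval hHG x.rep
    have h3 : (fun i => eval (evalTuple G.form x) (H.form i)) ≠ 0 :=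
      (h2.trans_ne (smul_ne_zero (hU x hx) x.rep_nonzero) :)
    have h4 := H.evalTuple_mk_ne_zero h0 h3
    refine (dif_pos h4).trans ?_
    rw [H.mk_evalTuple_mk h0 h3, mk_eq_mk_of_smul h3 x.rep_nonzero h2,
      Projectivization.mk_rep]

end RatMap.CompEqId

lemma basicOpen_nonempty [Infinite k] {p : CoordRing k n} (hp : p ≠ 0) {e : ℕ}
    (he : p.IsHomogeneous e) : (basicOpen p).Nonempty := by
  obtain ⟨v, hv⟩ : ∃ v, eval v (p * X 0) ≠ 0 := by
    by_contra! h
    exact mul_ne_zero hp (X_ne_zero 0) (MvPolynomial.funext fun v => by rw [h v, map_zero])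
  rw [map_mul, eval_X] at hv
  have hv0 : v ≠ 0 := fun h0 => right_ne_zero_of_mul hv (by simp [h0])
  exact ⟨Projectivization.mk k v hv0,
    fun h => left_ne_zero_of_mul hv ((eval_rep_mk_eq_zero_iff he hv0).1 h)⟩

/-- A Cremona map that maps every hyperplane through `o` to itself is a de Jonquières map. -/
lemma mem_deJonquieres_of_comb_eq [Infinite k] {m : ℕ} {o : ProjSpace k (m + 1)}
    {G : RatMap k (m + 1)} (hG : G.IsCremona) {g : CoordRing k (m + 1)} {c : ℕ}
    (hg : g.IsHomogeneous c) (hg0 : g ≠ 0)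
    (h : ∀ v ∈ orth o.rep, G.comb v = g * linForm v) : G ∈ deJonquieres o m := by
  have hG' := hG
  obtain ⟨H, ⟨q, hq0, hGH⟩, ⟨p, hp0, hHG⟩⟩ := hG
  have hp := RatMap.CompEqId.isHomogeneous hHG
  have hq := RatMap.CompEqId.isHomogeneous hGH
  have hne : isoLocus G p q g ≠ 0 := by
    refine mul_ne_zero (mul_ne_zero hp0 fun h0 => hq0 ?_) hg0
    exact RatMap.CompEqId.eq_zero_of_bind₁_eq_zero ⟨q, hq0, hGH⟩ hq h0
  have hhom := RatMap.CompEqId.isHomogeneous_isoLocus G hp hq hg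
  refine ⟨hG', basicOpen (isoLocus G p q g), isOpen_basicOpen hhom, basicOpen_nonempty hne hhom,
    RatMap.CompEqId.isBiregularOn_basicOpen hHG hGH hp hq hg, ?_⟩
  rintro L ⟨ho, W, hW, rfl⟩ hne
  have hWt : W ≠ ⊤ := by
    rintro rfl
    rw [finrank_top, Module.finrank_fintype_fun_eq_card, Fintype.card_fin] at hW
    omega
  obtain ⟨v, hv, hWv⟩ := exists_le_orth hWt
  obtain rfl : W = orth v :=
    Submodule.eq_of_le_of_finrank_eq hWv (by rw [hW, finrank_orth hv])
  have hvo : v ∈ orth o.rep := mem_orth_comm.1 (submodule_le_iff_rep_mem.1 ho)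
  have himage : G.image ({x | x.submodule ≤ orth v} ∩ basicOpen (isoLocus G p q g)) =
      {x | x.submodule ≤ orth v} ∩ basicOpen (isoLocus H q p (bind₁ H.form g)) := by
    ext y
    rw [RatMap.CompEqId.mem_image_iff hHG hGH hp hq hg, Set.mem_inter_iff, and_comm]
    refine and_congr_left fun hy => ?_
    rw [basicOpen, Set.mem_ofPred, RatMap.CompEqId.eval_isoLocus, eval_bind₁] at hy
    have hqy := left_ne_zero_of_mul (left_ne_zero_of_mul hy)
    have hHy : evalTuple H.form y ≠ 0 := RatMap.CompEqId.eval_ne_zero hGH y.rep_nonzero hqy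
    have key := congrArg (eval (evalTuple H.form y)) (h v hvo)
    have h2 : (fun i => eval (evalTuple H.form y) (G.form i)) = _ :=
      RatMap.CompEqId.eval_eval hGH y.rep
    rw [RatMap.eval_comb, h2, map_mul, eval_linForm, dotProduct_smul, smul_eq_mul] at key
    have hiff : v ⬝ᵥ evalTuple H.form y = 0 ↔ v ⬝ᵥ y.rep = 0 := by
      constructor <;> intro h0
      · rw [h0, mul_zero] at key
        exact (mul_eq_zero.1 key).resolve_left hqy
      · rw [h0, mul_zero] at key
        exact (mul_eq_zero.1 key.symm).resolve_left (right_ne_zero_of_mul hy)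
    rw [Set.mem_ofPred, submodule_le_iff_rep_mem, mem_orth, ← hiff, ← mem_orth,
      ← rep_mk_mem_iff hHy, ← submodule_le_iff_rep_mem]
    exact ⟨fun ⟨_, h0⟩ => h0, fun h0 => ⟨hHy, h0⟩⟩
  have hne' : (G.image ({x | x.submodule ≤ orth v} ∩ basicOpen (isoLocus G p q g))).Nonempty := by
    obtain ⟨x, hx⟩ := hne
    have h1 := hx.2
    rw [basicOpen, Set.mem_ofPred, RatMap.CompEqId.eval_isoLocus] at h1
    exact ⟨_, x, hx, RatMap.CompEqId.eval_ne_zero hHG x.rep_nonzero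
      (left_ne_zero_of_mul (left_ne_zero_of_mul h1)), rfl⟩
  rw [himage] at hne' ⊢
  rw [closure_inter_basicOpen hne' (RatMap.CompEqId.isHomogeneous_isoLocus H hq hp
    (isHomogeneous_bind₁ hg H.isHomogeneous))]
  exact ⟨ho, orth v, hW, rfl⟩

lemma RatMap.IsConeType.exists_mem_deJonquieres [Infinite k] {F : RatMap k 3}
    (hF : F.IsCremona) (h : F.IsConeType) (o : ProjSpace k 3) :
    ∃ G ∈ deJonquieres o 2, F.LinearlyEquivalent G := by
  obtain ⟨A, B, g, hg⟩ := h
  obtain ⟨T, hT⟩ := exists_gl_mulVec_last o.rep_nonzero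
  refine ⟨F.conj (T * A) (B * T⁻¹), ?_, linearlyEquivalent_conj _ _ _⟩
  have hF' := hF.conj A B
  have hg0 : g ≠ 0 := by
    rintro rfl
    have h0 : (F.conj A B).comb (Pi.single 0 1) = 0 := by
      have := hg 0
      rw [zero_mul] at this
      simpa [comb] using this
    have := hF'.comb_injective (h0.trans (map_zero _).symm)
    simpa using congrFun this 0
  have hgh : g.IsHomogeneous (F.degree - 1) := by
    refine isHomogeneous_of_mul_X (i := 0) ?_
    have := (F.conj A B).isHomogeneous 0
    rwa [show (F.conj A B).form 0 = g * X 0 from hg 0] at this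
  refine mem_deJonquieres_of_comb_eq (hF.conj _ _) (g := subst (T⁻¹).1 g)
    (isHomogeneous_subst hgh _) (fun h0 => hg0 ?_) fun v hv => ?_
  · rw [← subst_subst_inv T g, h0, map_zero]
  have h1 : (F.conj (T * A) (B * T⁻¹)).comb v = ((F.conj A B).conj T T⁻¹).comb v := by
    rw [comb_apply, comb_apply, conj_conj_form]
  have h2 : Matrix.vecMul v T.1 (Fin.last 3) = 0 := by
    rw [mem_orth_comm, mem_orth, ← hT, Matrix.dotProduct_mulVec] at hv
    simpa using hv
  have h3 : ∀ w : Fin 4 → k, w (Fin.last 3) = 0 → (F.conj A B).comb w = g * linForm w := by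
    intro w hw
    rw [comb_apply, linForm_apply, Fin.sum_univ_castSucc (n := 3),
      Fin.sum_univ_castSucc (n := 3), hw, map_zero,
      zero_mul, zero_mul, add_zero, add_zero, Finset.mul_sum]
    exact Finset.sum_congr rfl fun i _ => by rw [hg i]; ring
  rw [h1, conj_comb, h3 _ h2, map_mul, subst_linForm, Matrix.vecMul_vecMul, ← Units.val_mul,
    mul_inv_cancel, Units.val_one, Matrix.vecMul_one]

/-! ### The last form of a Cremona map of cone type -/

lemma homogeneousComponent_mul_of_isHomogeneous {q : CoordRing k n} {e : ℕ}
    (hq : q.IsHomogeneous e) (p : CoordRing k n) (m : ℕ) :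
    homogeneousComponent (m + e) (p * q) = homogeneousComponent m p * q := by
  conv_lhs => rw [← sum_homogeneousComponent p, Finset.sum_mul, map_sum]
  have h : ∀ i, homogeneousComponent (m + e) (homogeneousComponent i p * q) =
      if m = i then homogeneousComponent i p * q else 0 := by
    intro i
    rw [homogeneousComponent_of_mem (m := m + e) (n := i + e)
      ((homogeneousComponent_isHomogeneous i p).mul hq)]
    simp
  simp only [h, Finset.sum_ite_eq]
  split_ifs with hm
  · rfl
  · rw [Finset.mem_range, not_lt, Nat.add_one_le_iff] at hm
    rw [homogeneousComponent_eq_zero _ _ hm, zero_mul]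

/-- The substitution that sets the variables in a set `s` to zero. -/
noncomputable def killVars (s : Set (Fin (n + 1))) : CoordRing k n →ₐ[k] CoordRing k n :=
  open Classical in bind₁ fun i => if i ∈ s then 0 else X i

lemma killVars_X_of_mem {s : Set (Fin (n + 1))} {i : Fin (n + 1)} (hi : i ∈ s) :
    killVars (k := k) s (X i) = 0 := by
  simp [killVars, hi]

lemma killVars_X_of_notMem {s : Set (Fin (n + 1))} {i : Fin (n + 1)} (hi : i ∉ s) :
    killVars (k := k) s (X i) = X i := by
  simp [killVars, hi]

lemma sub_killVars_mem (s : Set (Fin (n + 1))) (p : CoordRing k n) :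
    p - killVars s p ∈ Ideal.span (X '' s : Set (CoordRing k n)) := by
  refine sub_bind₁_mem (fun i => ?_) p
  split_ifs with h
  · rw [sub_zero]; exact Ideal.subset_span ⟨i, h, rfl⟩
  · rw [sub_self]; exact zero_mem _

lemma ker_killVars (s : Set (Fin (n + 1))) :
    RingHom.ker (killVars (k := k) s) = Ideal.span (X '' s : Set (CoordRing k n)) := by
  apply le_antisymm
  · intro p hp
    have := sub_killVars_mem s p
    rwa [RingHom.mem_ker.1 hp, sub_zero] at this
  · rw [Ideal.span_le]
    rintro _ ⟨i, hi, rfl⟩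
    exact RingHom.mem_ker.2 (killVars_X_of_mem hi)

lemma isPrime_span_X_image (s : Set (Fin (n + 1))) :
    (Ideal.span (X '' s : Set (CoordRing k n))).IsPrime := by
  rw [← ker_killVars]
  exact RingHom.ker_isPrime _

lemma killVars_killVars (s : Set (Fin (n + 1))) (p : CoordRing k n) :
    killVars s (killVars s p) = killVars s p := by
  have : (killVars (k := k) s).comp (killVars s) = killVars s := by
    apply algHom_ext
    intro i
    by_cases hi : i ∈ s
    · simp [killVars_X_of_mem hi]
    · simp [killVars_X_of_notMem hi]
  exact DFunLike.congr_fun this p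

lemma degreeOf_killVars {s : Set (Fin (n + 1))} {i : Fin (n + 1)} (hi : i ∈ s)
    (p : CoordRing k n) : degreeOf i (killVars s p) = 0 := by
  classical
  by_contra h
  rw [← ne_eq, ← mem_vars_iff_degreeOf_ne_zero] at h
  obtain ⟨j, -, hj⟩ := Finset.mem_biUnion.1 (vars_bind₁ _ _ h)
  split_ifs at hj with hjs
  · simp at hj
  · rw [vars_X, Finset.mem_singleton] at hj
    exact hjs (hj ▸ hi)

lemma card_le_height_span_X (s : Finset (Fin (n + 1))) :
    (s.card : ℕ∞) ≤ (Ideal.span (X '' (s : Set (Fin (n + 1))) : Set (CoordRing k n))).height := by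
  classical
  induction s using Finset.induction_on with
  | empty => simp
  | insert i s hi ih =>
    have := isPrime_span_X_image (k := k) (s : Set (Fin (n + 1)))
    have := isPrime_span_X_image (k := k) ((insert i s : Finset _) : Set (Fin (n + 1)))
    rw [Finset.card_insert_of_notMem hi, Nat.cast_add, Nat.cast_one]
    refine le_trans (by gcongr) (Ideal.height_add_one_le_of_lt_of_isPrime (lt_of_le_of_ne
      (Ideal.span_mono (Set.image_mono (by simp))) fun h => ?_))
    have h1 : (X i : CoordRing k n) ∈ Ideal.span (X '' (s : Set (Fin (n + 1)))) := by
      rw [h]; exact Ideal.subset_span ⟨i, by simp, rfl⟩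
    rw [← ker_killVars, RingHom.mem_ker, killVars_X_of_notMem (by simpa using hi)] at h1
    exact X_ne_zero i h1

lemma mem_irrelevantIdeal_of_isHomogeneous {p : CoordRing k n} {e : ℕ} (hp : p.IsHomogeneous e)
    (he : e ≠ 0) : p ∈ irrelevantIdeal k n := by
  rw [irrelevantIdeal, ← Set.image_univ, mem_ideal_span_X_image]
  intro m hm
  by_contra! h
  have := hp.degree_eq_sum_deg_support hm
  exact he (this.trans (by simp [h]))

lemma isRelPrime_last_form {G : RatMap k 3} {g : CoordRing k 3}
    (hg : ∀ i : Fin 3, G.form i.castSucc = g * X i.castSucc) : IsRelPrime g (G.form 3) :=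
  fun p hpg hpf => G.no_fixed_part p fun i => by
    induction i using Fin.lastCases with
    | last => exact hpf
    | cast i => rw [hg]; exact hpg.mul_right _

/-- The last form of a Cremona map `(g x₀ : g x₁ : g x₂ : f)` has degree at most one in `x₃`: modulo
`f`, the equation saying that the inverse map `(δ x₀ : δ x₁ : δ x₂ : e)` recovers `x₃` reads
`e(x₀, x₁, x₂, 0) = x₃ δ(x₀, x₁, x₂, 0)`, up to a power of `g`, which is prime to `f`. -/
lemma degreeOf_last_form_le_one {G : RatMap k 3} (hG : G.IsCremona)
    {g : CoordRing k 3} (hg : ∀ i : Fin 3, G.form i.castSucc = g * X i.castSucc) :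
    degreeOf 3 (G.form 3) ≤ 1 := by
  have hrel := isRelPrime_last_form hg
  obtain ⟨H, ⟨q, hq0, hGH⟩, ⟨p, hp0, hHG⟩⟩ := hG
  -- the inverse has the same shape
  have hgH : ∀ i : Fin 3, bind₁ H.form g * H.form i.castSucc = q * X i.castSucc := fun i => by
    rw [← hGH, hg, map_mul, bind₁_X_right]
  have hgH0 : bind₁ H.form g ≠ 0 := by
    intro h0
    have := hgH 0
    rw [h0, zero_mul] at this
    exact mul_ne_zero hq0 (X_ne_zero _) this.symm
  obtain ⟨δ, hδ⟩ := exists_eq_mul_X (a := fun i : Fin 3 => H.form i.castSucc)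
    (Fin.castSucc_injective 3) (fun i => by
      apply mul_left_cancel₀ hgH0
      linear_combination X (Fin.castSucc 0) * hgH i - X i.castSucc * hgH 0)
  have hδh : δ.IsHomogeneous (H.degree - 1) :=
    isHomogeneous_of_mul_X (i := (0 : Fin 3).castSucc) (hδ 0 ▸ H.isHomogeneous _)
  have hp : p = bind₁ G.form δ * g := by
    apply mul_right_cancel₀ (X_ne_zero (R := k) (Fin.castSucc (0 : Fin 3)))
    rw [← hHG, hδ, map_mul, bind₁_X_right, hg]
    ring
  have he := hHG 3
  rw [hp] at he
  -- reduction modulo the last form of `G`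
  obtain ⟨κ, hκ⟩ : ∃ κ, κ = killVars (k := k) ({3} : Set (Fin 4)) := ⟨_, rfl⟩
  have h3 : (3 : Fin 4) ∈ ({3} : Set (Fin 4)) := Set.mem_singleton _
  have hred : ∀ {r : CoordRing k 3} {e : ℕ}, r.IsHomogeneous e →
      G.form 3 ∣ bind₁ G.form r - g ^ e * κ r := by
    intro r e hr
    have h1 : κ r = bind₁ (fun i => κ (X i)) r := by
      simp [hκ, killVars]
    rw [h1, ← bind₁_mul_of_isHomogeneous hr, ← Ideal.mem_span_singleton]
    refine bind₁_sub_bind₁_mem (fun i => ?_) r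
    induction i using Fin.lastCases with
    | last =>
      rw [show κ (X (Fin.last 3)) = 0 from hκ ▸ killVars_X_of_mem h3, mul_zero, sub_zero]
      exact Ideal.mem_span_singleton_self _
    | cast i =>
      rw [show κ (X i.castSucc) = X i.castSucc from
        hκ ▸ killVars_X_of_notMem (by simpa using (Fin.castSucc_lt_last i).ne), hg, sub_self]
      exact zero_mem _
  have hdvd : G.form 3 ∣ g ^ H.degree * (κ (H.form 3) - κ δ * X 3) := by
    obtain ⟨u, hu⟩ := hred (H.isHomogeneous 3)
    obtain ⟨v, hv⟩ := hred hδh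
    obtain ⟨m, hm⟩ : ∃ m, H.degree = m + 1 := ⟨H.degree - 1, by have := H.one_le_degree; omega⟩
    rw [hm] at hu hv ⊢
    rw [Nat.add_sub_cancel] at hv
    refine ⟨v * g * X 3 - u, ?_⟩
    linear_combination -hu + hv * g * X 3 + he
  have hdvd' : G.form 3 ∣ κ (H.form 3) - κ δ * X 3 := by
    have : IsRelPrime (G.form 3) (g ^ H.degree) :=
      hrel.symm.pow_right
    exact this.dvd_of_dvd_mul_left hdvd
  have hne : κ (H.form 3) - κ δ * X 3 ≠ 0 := by
    intro h0
    have hκX : κ (X 3) = 0 := hκ ▸ killVars_X_of_mem h3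
    have h1 : κ (H.form 3) = 0 := by
      have := congrArg κ h0
      rwa [map_sub, map_mul, hκX, mul_zero, sub_zero, map_zero, hκ, killVars_killVars, ← hκ] at this
    have h2 : κ δ = 0 := by
      rw [h1, zero_sub, neg_eq_zero] at h0
      exact (mul_eq_zero.1 h0).resolve_right (X_ne_zero _)
    have hdiv : ∀ r, κ r = 0 → X 3 ∣ r := fun r hr => by
      have : r ∈ RingHom.ker (killVars (k := k) ({3} : Set (Fin 4))) := by
        rwa [RingHom.mem_ker, ← hκ]
      rwa [ker_killVars, Set.image_singleton, Ideal.mem_span_singleton] at this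
    refine X_prime.not_isUnit (H.no_fixed_part (X 3) fun i => ?_)
    induction i using Fin.lastCases with
    | last => exact hdiv _ h1
    | cast i =>
      rw [show H.form i.castSucc = _ from hδ i]
      exact (hdiv _ h2).mul_right _
  obtain ⟨r, hr⟩ := hdvd'
  have hr0 : r ≠ 0 := by rintro rfl; exact hne (by rw [hr, mul_zero])
  have hf0 : G.form 3 ≠ 0 := by intro h; exact hne (by rw [hr, h, zero_mul])
  have h1 := degreeOf_mul_eq (n := (3 : Fin 4)) hf0 hr0
  rw [← hr] at h1
  have h2 := degreeOf_sub_le 3 (κ (H.form 3)) (κ δ * X 3)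
  have h7 := degreeOf_mul_le 3 (κ δ) (X 3)
  have h4 : degreeOf 3 (κ (H.form 3)) = 0 := hκ ▸ degreeOf_killVars h3 _
  have h5 : degreeOf 3 (κ δ) = 0 := hκ ▸ degreeOf_killVars h3 _
  have h6 : degreeOf 3 (X 3 : CoordRing k 3) = 1 := by rw [degreeOf_X, if_pos rfl]
  omega

/-- The last form of a Cremona map `(g x₀ : g x₁ : g x₂ : f)` of degree at least two vanishes at
the point `(0 : 0 : 0 : 1)`. -/
lemma exists_last_form_eq {G : RatMap k 3} (hG : G.IsCremona) (hd : 2 ≤ G.degree)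
    {g : CoordRing k 3} (hg : ∀ i : Fin 3, G.form i.castSucc = g * X i.castSucc) :
    ∃ f : Fin 3 → CoordRing k 3, (∀ i, (f i).IsHomogeneous (G.degree - 1)) ∧
      G.form 3 = ∑ i, f i * X i.castSucc := by
  have hdeg := degreeOf_last_form_le_one hG hg
  have hmem : G.form 3 ∈
      Ideal.span (Set.range fun i : Fin 3 => (X i.castSucc : CoordRing k 3)) := by
    have : (Set.range fun i : Fin 3 => (X i.castSucc : CoordRing k 3)) =
        X '' Set.range (Fin.castSucc : Fin 3 → Fin 4) := by
      rw [← Set.range_comp]; rfl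
    rw [this, mem_ideal_span_X_image]
    intro m hm
    have h1 := (monomial_le_degreeOf 3 hm).trans hdeg
    have h2 := (G.isHomogeneous 3).degree_eq_sum_deg_support hm
    have h3 : m.degree = ∑ i : Fin 3, m i.castSucc + m 3 := by
      rw [Finsupp.degree_eq_sum, Fin.sum_univ_castSucc]; rfl
    by_contra! h
    have h4 : ∑ i : Fin 3, m i.castSucc = 0 := Finset.sum_eq_zero fun i _ => h _ ⟨i, rfl⟩
    have h5 : G.degree = m.degree := h2
    omega
  obtain ⟨c, hc⟩ := Ideal.mem_span_range_iff_exists_fun.1 hmem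
  refine ⟨fun i => homogeneousComponent (G.degree - 1) (c i),
    fun i => homogeneousComponent_isHomogeneous _ _, ?_⟩
  have h1 := congrArg (homogeneousComponent G.degree) hc
  rw [homogeneousComponent_eq_self (G.isHomogeneous 3), map_sum] at h1
  rw [← h1]
  refine Finset.sum_congr rfl fun i _ => ?_
  rw [← homogeneousComponent_mul_of_isHomogeneous (isHomogeneous_X k _), Nat.sub_add_cancel]
  exact G.one_le_degree

/-! ### The resolution of the base ideal of a map of cone type -/

/-- Exactness of the Koszul complex of three variables in the middle. -/
lemma exists_koszul_X {a : Fin 3 → CoordRing k 3}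
    (h : ∑ i, a i * X i.castSucc = 0) :
    ∃ b : Fin 3 → CoordRing k 3, a 0 = X 2 * b 1 - X 1 * b 2 ∧ a 1 = X 0 * b 2 - X 2 * b 0 ∧
      a 2 = X 1 * b 0 - X 0 * b 1 := by
  rw [Fin.sum_univ_three] at h
  change a 0 * X 0 + a 1 * X 1 + a 2 * X 2 = 0 at h
  have hP := isPrime_span_X_image (k := k) ({0, 1} : Set (Fin 4))
  have h2 : a 2 ∈ Ideal.span (X '' ({0, 1} : Set (Fin 4)) : Set (CoordRing k 3)) := by
    refine (hP.mem_or_mem (x := a 2) (y := X 2) ?_).resolve_right fun h0 => ?_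
    · rw [show a 2 * X 2 = -(a 0 * X 0) - a 1 * X 1 by linear_combination h]
      exact sub_mem (neg_mem (Ideal.mul_mem_left _ _ (Ideal.subset_span ⟨0, by simp, rfl⟩)))
        (Ideal.mul_mem_left _ _ (Ideal.subset_span ⟨1, by simp, rfl⟩))
    · rw [← ker_killVars, RingHom.mem_ker, killVars_X_of_notMem (by simp)] at h0
      exact X_ne_zero _ h0
  rw [Set.image_pair, Ideal.mem_span_pair] at h2
  obtain ⟨u, v, huv⟩ := h2
  have h1 : X 0 * (a 0 + u * X 2) + X 1 * (a 1 + v * X 2) = 0 := by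
    linear_combination h + X 2 * huv
  obtain ⟨w, hw⟩ : X 0 ∣ a 1 + v * X 2 := by
    refine (X_prime.dvd_or_dvd (a := X 1) ⟨-(a 0 + u * X 2), by linear_combination h1⟩).resolve_left
      fun h0 => ?_
    rw [X_dvd_X] at h0
    simp at h0
  have h0 : a 0 + u * X 2 + X 1 * w = 0 := by
    apply mul_left_cancel₀ (X_ne_zero (R := k) (0 : Fin 4))
    rw [mul_zero]
    linear_combination h1 - X 1 * hw
  refine ⟨![v, -u, w], ?_, ?_, ?_⟩ <;>
    simp only [Matrix.cons_val_zero, Matrix.cons_val_one, Matrix.cons_val]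
  · linear_combination h0
  · linear_combination hw
  · linear_combination -huv

/-- The linear forms that are the images of the first three variables under a linear change of
coordinates. -/
noncomputable def coneForm (B : GL (Fin 4) k) (i : Fin 3) : CoordRing k 3 :=
  subst B.1 (X i.castSucc)

lemma coneForm_isHomogeneous (B : GL (Fin 4) k) (i : Fin 3) :
    (coneForm B i).IsHomogeneous 1 := isHomogeneous_subst (isHomogeneous_X _ _) _

lemma coneForm_ne_zero (B : GL (Fin 4) k) (i : Fin 3) : coneForm B i ≠ 0 := by
  intro h
  have := subst_inv_subst B (X i.castSucc)
  rw [show subst B.1 (X i.castSucc) = 0 from h, map_zero] at this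
  exact X_ne_zero _ this.symm

lemma exists_koszul_coneForm (B : GL (Fin 4) k) {a : Fin 3 → CoordRing k 3}
    (h : ∑ i, a i * coneForm B i = 0) :
    ∃ b : Fin 3 → CoordRing k 3,
      a 0 = coneForm B 2 * b 1 - coneForm B 1 * b 2 ∧
      a 1 = coneForm B 0 * b 2 - coneForm B 2 * b 0 ∧
      a 2 = coneForm B 1 * b 0 - coneForm B 0 * b 1 := by
  have h1 := congrArg (subst (B⁻¹).1) h
  simp only [map_sum, map_mul, coneForm, subst_inv_subst, map_zero] at h1
  obtain ⟨b, h0, h1, h2⟩ := exists_koszul_X h1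
  refine ⟨fun i => subst B.1 (b i), ?_, ?_, ?_⟩
  · have h := congrArg (subst B.1) h0
    simp only [subst_subst_inv, map_sub, map_mul] at h
    exact h
  · have h := congrArg (subst B.1) h1
    simp only [subst_subst_inv, map_sub, map_mul] at h
    exact h
  · have h := congrArg (subst B.1) h2
    simp only [subst_subst_inv, map_sub, map_mul] at h
    exact h

lemma exists_eq_mul_coneForm (B : GL (Fin 4) k) {b : Fin 3 → CoordRing k 3}
    (h : ∀ i, coneForm B 0 * b i = coneForm B i * b 0) :
    ∃ s, ∀ i, b i = s * coneForm B i := by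
  obtain ⟨s, hs⟩ := exists_eq_mul_X (a := fun i => subst (B⁻¹).1 (b i))
    (Fin.castSucc_injective 3) (fun i => by
      have := congrArg (subst (B⁻¹).1) (h i)
      simpa only [map_mul, coneForm, subst_inv_subst] using this)
  refine ⟨subst B.1 s, fun i => ?_⟩
  have := congrArg (subst B.1) (hs i)
  rwa [map_mul, subst_subst_inv] at this

section GradedMaps

variable {ι₁ ι₂ : Type*}

lemma mem_twistedPart {a : ι₁ → ℕ} {e : ℕ} {v : ι₁ → CoordRing k n} :
    v ∈ twistedPart (k := k) a e ↔ ∀ i, v i = 0 ∨ a i ≤ e ∧ (v i).IsHomogeneous (e - a i) := by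
  simp only [twistedPart, Submodule.mem_pi, Set.mem_univ, true_implies]
  refine forall_congr' fun i => ?_
  split_ifs with h
  · rw [mem_homogeneousSubmodule]
    exact ⟨fun h' => Or.inr ⟨h, h'⟩, fun h' => h'.elim (fun h0 => h0 ▸ isHomogeneous_zero _ _ _)
      And.right⟩
  · simp [h]

lemma mulVec_mem_twistedPart [Fintype ι₂] {a : ι₁ → ℕ} {b : ι₂ → ℕ}
    {M : Matrix ι₁ ι₂ (CoordRing k n)}
    (hM : ∀ i j, M i j = 0 ∨ a i ≤ b j ∧ (M i j).IsHomogeneous (b j - a i)) {e : ℕ}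
    {v : ι₂ → CoordRing k n} (hv : v ∈ twistedPart (k := k) b e) :
    M.mulVec v ∈ twistedPart (k := k) a e := by
  rw [mem_twistedPart] at hv ⊢
  intro i
  by_cases hi : a i ≤ e
  · refine Or.inr ⟨hi, IsHomogeneous.sum _ _ _ fun j _ => ?_⟩
    rcases hM i j with h | ⟨h, hM⟩
    · simpa [h] using isHomogeneous_zero _ _ _
    rcases hv j with h' | ⟨h', hv⟩
    · simpa [h'] using isHomogeneous_zero _ _ _
    have := hM.mul hv
    rwa [show b j - a i + (e - b j) = e - a i by omega] at this
  · refine Or.inl (Finset.sum_eq_zero fun j _ => ?_)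
    change M i j * v j = 0
    rcases hM i j with h | ⟨h, -⟩
    · rw [h, zero_mul]
    rcases hv j with h' | ⟨h', -⟩
    · rw [h', mul_zero]
    omega

lemma range_mulVecLin_le [Fintype ι₁] [Fintype ι₂] {R : Type*} [CommRing R] {I : Ideal R}
    {M : Matrix ι₁ ι₂ R} (hM : ∀ i j, M i j ∈ I) :
    LinearMap.range M.mulVecLin ≤ I • (⊤ : Submodule R (ι₁ → R)) := by
  classical
  rintro _ ⟨v, rfl⟩
  have : M.mulVecLin v = ∑ i, (M.mulVec v i) • Pi.single i (1 : R) := by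
    rw [Matrix.mulVecLin_apply]
    exact pi_eq_sum_univ' _
  rw [this]
  exact Submodule.sum_mem _ fun i _ => Submodule.smul_mem_smul
    (Ideal.sum_mem _ fun j _ => I.mul_mem_right _ (hM i j)) trivial

end GradedMaps

section Resolution

variable {B : GL (Fin 4) k} {g : CoordRing k 3} {f : Fin 3 → CoordRing k 3} {d : ℕ}

/-- The generators `g l₀, g l₁, g l₂, f₀ l₀ + f₁ l₁ + f₂ l₂`. -/
noncomputable def coneGens (B : GL (Fin 4) k) (g : CoordRing k 3) (f : Fin 3 → CoordRing k 3) :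
    Fin 4 → CoordRing k 3 :=
  ![g * coneForm B 0, g * coneForm B 1, g * coneForm B 2, ∑ i, f i * coneForm B i]

/-- The relations between `coneGens`: the Koszul relations between the linear forms, and
`g · (∑ fᵢ lᵢ) = ∑ fᵢ · (g lᵢ)`. -/
noncomputable def coneSyz (B : GL (Fin 4) k) (g : CoordRing k 3) (f : Fin 3 → CoordRing k 3) :
    Matrix (Fin 4) (Fin 4) (CoordRing k 3) :=
  !![0, coneForm B 2, -coneForm B 1, -f 0;
    -coneForm B 2, 0, coneForm B 0, -f 1;
    coneForm B 1, -coneForm B 0, 0, -f 2;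
    0, 0, 0, g]

/-- The relation between the columns of `coneSyz`. -/
noncomputable def coneSyz₂ (B : GL (Fin 4) k) : Matrix (Fin 4) (Fin 1) (CoordRing k 3) :=
  !![coneForm B 0; coneForm B 1; coneForm B 2; 0]

lemma linearCombination_coneGens (v : Fin 4 → CoordRing k 3) :
    Fintype.linearCombination (CoordRing k 3) (coneGens B g f) v =
      g * (∑ i, v i.castSucc * coneForm B i) + v 3 * ∑ i, f i * coneForm B i := by
  simp only [Fintype.linearCombination_apply, coneGens, Fin.sum_univ_four, Fin.sum_univ_three,
    smul_eq_mul]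
  simp [show (1 : Fin 3).castSucc = (1 : Fin 4) from rfl,
    show (2 : Fin 3).castSucc = (2 : Fin 4) from rfl]
  ring

lemma coneSyz_mulVec (v : Fin 4 → CoordRing k 3) :
    (coneSyz B g f).mulVec v =
      ![coneForm B 2 * v 1 - coneForm B 1 * v 2 - f 0 * v 3,
        coneForm B 0 * v 2 - coneForm B 2 * v 0 - f 1 * v 3,
        coneForm B 1 * v 0 - coneForm B 0 * v 1 - f 2 * v 3, g * v 3] := by
  ext1 i
  fin_cases i <;> simp [coneSyz, Matrix.mulVec, dotProduct, Fin.sum_univ_four] <;> ring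

lemma coneSyz₂_mulVec (v : Fin 1 → CoordRing k 3) :
    (coneSyz₂ B).mulVec v =
      ![coneForm B 0 * v 0, coneForm B 1 * v 0, coneForm B 2 * v 0, 0] := by
  ext1 i
  fin_cases i <;> simp [coneSyz₂, Matrix.mulVec, dotProduct]

lemma exact_coneSyz_coneGens (hg : g ≠ 0) (hrel : IsRelPrime g (∑ i, f i * coneForm B i)) :
    Function.Exact (coneSyz B g f).mulVecLin
      (Fintype.linearCombination (CoordRing k 3) (coneGens B g f)) := by
  intro v
  rw [linearCombination_coneGens]
  constructor
  · intro h
    obtain ⟨w, hw⟩ : g ∣ v 3 := hrel.dvd_of_dvd_mul_right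
      ⟨-(∑ i, v i.castSucc * coneForm B i), by linear_combination h⟩
    have h1 : ∑ i, (v i.castSucc + w * f i) * coneForm B i = 0 := by
      apply mul_left_cancel₀ hg
      rw [mul_zero, ← h, hw]
      simp only [add_mul, Finset.sum_add_distrib, mul_add, Finset.mul_sum]
      exact congrArg _ (Finset.sum_congr rfl fun i _ => by ring)
    obtain ⟨b, h0, h1, h2⟩ := exists_koszul_coneForm B h1
    refine ⟨![b 0, b 1, b 2, w], ?_⟩
    rw [Matrix.mulVecLin_apply, coneSyz_mulVec]
    ext1 i
    fin_cases i <;> simp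
    · change v 0 + w * f 0 = _ at h0
      linear_combination -h0
    · change v 1 + w * f 1 = _ at h1
      linear_combination -h1
    · change v 2 + w * f 2 = _ at h2
      linear_combination -h2
    · exact hw.symm
  · rintro ⟨w, rfl⟩
    rw [Matrix.mulVecLin_apply, coneSyz_mulVec]
    simp only [Fin.sum_univ_three]
    simp [show (1 : Fin 3).castSucc = (1 : Fin 4) from rfl,
      show (2 : Fin 3).castSucc = (2 : Fin 4) from rfl]
    ring

lemma exact_coneSyz₂_coneSyz (hg : g ≠ 0) :
    Function.Exact (coneSyz₂ B).mulVecLin (coneSyz B g f).mulVecLin := by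
  intro v
  rw [Matrix.mulVecLin_apply, coneSyz_mulVec]
  constructor
  · intro h
    have h3 : v 3 = 0 := (mul_eq_zero.1 (congrFun h 3)).resolve_left hg
    have e0 : coneForm B 2 * v 1 - coneForm B 1 * v 2 - f 0 * v 3 = 0 := congrFun h 0
    have e1 : coneForm B 0 * v 2 - coneForm B 2 * v 0 - f 1 * v 3 = 0 := congrFun h 1
    have e2 : coneForm B 1 * v 0 - coneForm B 0 * v 1 - f 2 * v 3 = 0 := congrFun h 2
    rw [h3, mul_zero, sub_zero] at e0 e1 e2
    obtain ⟨s, hs⟩ := exists_eq_mul_coneForm B (b := ![v 0, v 1, v 2]) (fun i => by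
      fin_cases i <;> simp
      · linear_combination -e2
      · linear_combination e1)
    refine ⟨fun _ => s, ?_⟩
    rw [Matrix.mulVecLin_apply, coneSyz₂_mulVec]
    ext1 i
    fin_cases i
    · exact (mul_comm _ _).trans (hs 0).symm
    · exact (mul_comm _ _).trans (hs 1).symm
    · exact (mul_comm _ _).trans (hs 2).symm
    · exact h3.symm
  · rintro ⟨w, rfl⟩
    rw [Matrix.mulVecLin_apply, coneSyz₂_mulVec]
    ext1 i
    fin_cases i <;> simp <;> ring

lemma coneGens_isHomogeneous (hd : 2 ≤ d) (hg : g.IsHomogeneous (d - 1))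
    (hf : ∀ i, (f i).IsHomogeneous (d - 1)) (i : Fin 4) :
    (coneGens B g f i).IsHomogeneous d := by
  have h : ∀ {p : CoordRing k 3}, p.IsHomogeneous (d - 1) →
      ∀ i, (p * coneForm B i).IsHomogeneous d := by
    intro p hp i
    have := hp.mul (coneForm_isHomogeneous B i)
    rwa [Nat.sub_add_cancel (by omega)] at this
  fin_cases i
  · exact h hg 0
  · exact h hg 1
  · exact h hg 2
  · change (∑ i, f i * coneForm B i).IsHomogeneous d
    exact IsHomogeneous.sum _ _ _ fun i _ => h (hf i) i

lemma coneSyz_isHomogeneous (hd : 2 ≤ d) (hg : g.IsHomogeneous (d - 1))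
    (hf : ∀ i, (f i).IsHomogeneous (d - 1)) (i j : Fin 4) :
    coneSyz B g f i j = 0 ∨ d ≤ ![d + 1, d + 1, d + 1, 2 * d - 1] j ∧
      (coneSyz B g f i j).IsHomogeneous (![d + 1, d + 1, d + 1, 2 * d - 1] j - d) := by
  have h1 : d + 1 - d = 1 := by omega
  have h2 : 2 * d - 1 - d = d - 1 := by omega
  have h3 : d ≤ 2 * d - 1 := by omega
  have hl := coneForm_isHomogeneous B
  fin_cases i <;> fin_cases j <;>
    simp [coneSyz, h1, h2, h3, hl, hg, hf, IsHomogeneous.neg]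

lemma coneSyz₂_isHomogeneous (i : Fin 4) (j : Fin 1) :
    coneSyz₂ B i j = 0 ∨ ![d + 1, d + 1, d + 1, 2 * d - 1] i ≤ d + 2 ∧
      (coneSyz₂ B i j).IsHomogeneous (d + 2 - ![d + 1, d + 1, d + 1, 2 * d - 1] i) := by
  have h1 : d + 2 - (d + 1) = 1 := by omega
  have hl := coneForm_isHomogeneous B
  fin_cases i <;> simp [coneSyz₂, h1, hl]

lemma hasMinimalGradedFreeResolution_span_coneGens (hd : 2 ≤ d) (hg0 : g ≠ 0)
    (hg : g.IsHomogeneous (d - 1)) (hf : ∀ i, (f i).IsHomogeneous (d - 1))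
    (hrel : IsRelPrime g (∑ i, f i * coneForm B i)) :
    HasMinimalGradedFreeResolution (Ideal.span (Set.range (coneGens B g f)))
      (fun _ : Fin 4 => d) ![d + 1, d + 1, d + 1, 2 * d - 1] (fun _ : Fin 1 => d + 2) := by
  have hl : ∀ i, coneForm B i ∈ irrelevantIdeal k 3 := fun i =>
    mem_irrelevantIdeal_of_isHomogeneous (coneForm_isHomogeneous B i) one_ne_zero
  have hgI := mem_irrelevantIdeal_of_isHomogeneous hg (by omega)
  have hfI := fun i => mem_irrelevantIdeal_of_isHomogeneous (hf i) (by omega)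
  have hrange : LinearMap.range (Fintype.linearCombination (CoordRing k 3) (coneGens B g f)) =
      Ideal.span (Set.range (coneGens B g f)) := Fintype.range_linearCombination _ _
  refine ⟨Fintype.linearCombination (CoordRing k 3) (coneGens B g f), (coneSyz B g f).mulVecLin,
    (coneSyz₂ B).mulVecLin, ?_, ?_, ?_, ?_, exact_coneSyz₂_coneSyz hg0,
    exact_coneSyz_coneGens hg0 hrel, ?_, ?_, ?_, ?_⟩
  · intro e v hv
    rw [mem_twistedPart] at hv
    rw [Fintype.linearCombination_apply]
    refine IsHomogeneous.sum _ _ _ fun i _ => ?_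
    rcases hv i with h | ⟨h, hv⟩
    · simpa [h] using isHomogeneous_zero _ _ _
    · have := hv.mul (coneGens_isHomogeneous (B := B) hd hg hf i)
      rwa [Nat.sub_add_cancel h] at this
  · exact fun e v hv => mulVec_mem_twistedPart (coneSyz_isHomogeneous hd hg hf) hv
  · exact fun e v hv => mulVec_mem_twistedPart coneSyz₂_isHomogeneous hv
  · intro v w hvw
    simp only [Matrix.mulVecLin_apply, coneSyz₂_mulVec] at hvw
    ext1 i
    rw [Subsingleton.elim i 0]
    exact mul_left_cancel₀ (coneForm_ne_zero B 0) (congrFun hvw 0)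
  · rw [LinearMap.exact_iff, Submodule.ker_mkQ, hrange]
  · rw [hrange, Ideal.span_le]
    rintro _ ⟨i, rfl⟩
    exact mem_irrelevantIdeal_of_isHomogeneous (coneGens_isHomogeneous hd hg hf i) (by omega)
  · refine range_mulVecLin_le fun i j => ?_
    fin_cases i <;> fin_cases j <;> simp [coneSyz, hl, hgI, hfI]
  · refine range_mulVecLin_le fun i j => ?_
    fin_cases i <;> fin_cases j <;> simp [coneSyz₂, hl]

/-- The ideal generated by `coneGens` has the embedded component `(l₀, l₁, l₂)`: the form `g` lies in
all components of codimension two, but not in the ideal. -/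
lemma not_isUnmixed_span_coneGens (hd : 2 ≤ d) (hg0 : g ≠ 0)
    (hg : g.IsHomogeneous (d - 1))
    (hrel : IsRelPrime g (∑ i, f i * coneForm B i)) :
    ¬ IsUnmixed (Ideal.span (Set.range (coneGens B g f))) := by
  set J := Ideal.span (Set.range (coneGens B g f)) with hJ
  have hI1 : (1 : CoordRing k 3) ∉ irrelevantIdeal k 3 := by
    rw [irrelevantIdeal, ← Set.image_univ, ← ker_killVars, RingHom.mem_ker, map_one]
    exact one_ne_zero
  have hl : ∀ i, coneForm B i ∈ irrelevantIdeal k 3 := fun i =>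
    mem_irrelevantIdeal_of_isHomogeneous (coneForm_isHomogeneous B i) one_ne_zero
  have hgI := mem_irrelevantIdeal_of_isHomogeneous hg (by omega)
  have hfI : ∑ i, f i * coneForm B i ∈ irrelevantIdeal k 3 :=
    Ideal.sum_mem _ fun i _ => Ideal.mul_mem_left _ _ (hl i)
  have hgJ : g ∉ J := by
    rw [hJ, ← Ideal.submodule_span_eq, ← Fintype.range_linearCombination (CoordRing k 3)]
    rintro ⟨v, hv⟩
    rw [linearCombination_coneGens] at hv
    obtain ⟨w, hw⟩ : g ∣ v 3 := hrel.dvd_of_dvd_mul_right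
      ⟨1 - (∑ i, v i.castSucc * coneForm B i), by linear_combination hv⟩
    apply hI1
    have : 1 = ∑ i, v i.castSucc * coneForm B i + w * ∑ i, f i * coneForm B i := by
      apply mul_left_cancel₀ hg0
      linear_combination -hv + hw * (∑ i, f i * coneForm B i)
    rw [this]
    exact add_mem (Ideal.sum_mem _ fun i _ => Ideal.mul_mem_left _ _ (hl i))
      (Ideal.mul_mem_left _ _ hfI)
  have hgl : ∀ i, g * coneForm B i ∈ J := by
    intro i
    fin_cases i
    · exact Ideal.subset_span ⟨0, rfl⟩
    · exact Ideal.subset_span ⟨1, rfl⟩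
    · exact Ideal.subset_span ⟨2, rfl⟩
  have hheight : J.height ≤ 2 := by
    have hle : J ≤ Ideal.span {g, ∑ i, f i * coneForm B i} := by
      rw [hJ, Ideal.span_le]
      rintro _ ⟨i, rfl⟩
      rw [SetLike.mem_coe, Ideal.mem_span_pair]
      fin_cases i
      · exact ⟨coneForm B 0, 0, by simp [coneGens]; ring⟩
      · exact ⟨coneForm B 1, 0, by simp [coneGens]; ring⟩
      · exact ⟨coneForm B 2, 0, by simp [coneGens]; ring⟩
      · exact ⟨0, 1, by simp [coneGens]⟩
    have hne : Ideal.span {g, ∑ i, f i * coneForm B i} ≠ ⊤ := by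
      intro h
      apply hI1
      have h1 : Ideal.span {g, ∑ i, f i * coneForm B i} ≤ irrelevantIdeal k 3 := by
        rw [Ideal.span_le]
        rintro _ (rfl | rfl)
        · exact hgI
        · exact hfI
      exact h1 (h ▸ trivial)
    obtain ⟨P, hP⟩ := Ideal.nonempty_minimalPrimes hne
    have hPp := hP.1.1
    refine (Ideal.height_mono (hle.trans hP.1.2)).trans ?_
    refine (Ideal.height_le_card_of_mem_minimalPrimes_span (Set.toFinite _) hP).trans ?_
    exact_mod_cast (Set.ncard_insert_le _ _).trans (by rw [Set.ncard_singleton])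
  intro hunm
  refine hgJ (hunm ▸ ?_)
  rw [unmixedPart, Ideal.mem_sInf]
  rintro Q ⟨t, ht, hQt, hQ⟩
  by_contra hgQ
  have hJQ : J ≤ Q := by
    rw [← ht.inf_eq]
    exact Finset.inf_le hQt
  have hprim := Ideal.isPrimary_iff.1 (ht.primary hQt)
  have h3 : 3 ≤ Q.height := by
    rw [Ideal.height_eq_inf_minimalPrimes]
    refine le_iInf₂ fun P hP => ?_
    have hPp := hP.1.1
    have hlP : ∀ i, coneForm B i ∈ P := fun i =>
      hPp.radical_le_iff.2 hP.1.2 ((hprim.2 (hJQ (hgl i))).resolve_left hgQ)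
    rw [← RingEquiv.height_comap (substEquiv B).toRingEquiv P]
    refine le_trans ?_ (Ideal.height_mono (I := Ideal.span
      (X '' (((Finset.univ.map Fin.castSuccEmb : Finset (Fin 4))) : Set (Fin 4)))) ?_)
    · refine le_trans ?_ (card_le_height_span_X _)
      simp
    · rw [Ideal.span_le]
      rintro _ ⟨i, hi, rfl⟩
      simp only [Finset.coe_map, Set.mem_image, Finset.mem_coe, Finset.mem_univ, true_and] at hi
      obtain ⟨i, rfl⟩ := hi
      exact hlP i
  have := h3.trans (hQ.le.trans hheight)
  norm_num at this

end Resolution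

lemma RatMap.IsConeType.exists_span_coneGens {F : RatMap k 3} (hF : F.IsCremona)
    (hd : 2 ≤ F.degree) (h : F.IsConeType) :
    ∃ (B : GL (Fin 4) k) (g : CoordRing k 3) (f : Fin 3 → CoordRing k 3), g ≠ 0 ∧
      g.IsHomogeneous (F.degree - 1) ∧ (∀ i, (f i).IsHomogeneous (F.degree - 1)) ∧
      IsRelPrime g (∑ i, f i * coneForm B i) ∧
      F.baseIdeal = Ideal.span (Set.range (coneGens B g f)) := by
  obtain ⟨A, B, g, hg⟩ := h
  obtain ⟨f, hf, hf3⟩ := exists_last_form_eq (hF.conj A B) hd hg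
  have hrel := isRelPrime_last_form hg
  have hfB : subst (B⁻¹).1 ((F.conj A B).form 3) = ∑ i, subst (B⁻¹).1 (f i) * coneForm B⁻¹ i := by
    simp [hf3, coneForm]
  refine ⟨B⁻¹, subst (B⁻¹).1 g, fun i => subst (B⁻¹).1 (f i), ?_, ?_, fun i =>
    isHomogeneous_subst (hf i) _, ?_, ?_⟩
  · intro h0
    have hg0 : g = 0 := by rw [← subst_subst_inv B g, h0, map_zero]
    have h0 : (F.conj A B).comb (Pi.single 0 1) = 0 := by
      have := hg 0
      rw [hg0, zero_mul] at this
      simpa [comb] using this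
    have := (hF.conj A B).comb_injective (h0.trans (map_zero _).symm)
    simpa using congrFun this 0
  · refine isHomogeneous_subst (isHomogeneous_of_mul_X (i := 0) ?_) _
    have := (F.conj A B).isHomogeneous 0
    rwa [show (F.conj A B).form 0 = g * X 0 from hg 0] at this
  · rw [← hfB]
    intro p h1 h2
    have h1 := map_dvd (subst B.1) h1
    have h2 := map_dvd (subst B.1) h2
    rw [subst_subst_inv] at h1 h2
    have := (hrel h1 h2).map (subst (B⁻¹).1)
    rwa [subst_inv_subst] at this
  · rw [F.baseIdeal_eq_span_comb A]
    congr 2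
    ext1 i
    have hi : F.comb (A.1 i) = subst (B⁻¹).1 ((F.conj A B).form i) := by
      rw [conj_form, subst_inv_subst]
    rw [hi]
    fin_cases i
    · exact (congrArg _ (hg 0)).trans (map_mul _ _ _)
    · exact (congrArg _ (hg 1)).trans (map_mul _ _ _)
    · exact (congrArg _ (hg 2)).trans (map_mul _ _ _)
    · exact hfB

/-! ### Linear systems of skew-symmetric matrices of forms -/

lemma exists_eq_linForm {p : CoordRing k n} (hp : p.IsHomogeneous 1) : ∃ v, p = linForm v := by
  have h : p ∈ homogeneousSubmodule (Fin (n + 1)) k 1 := hp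
  rw [homogeneousSubmodule_one_eq_span_X, ← Fintype.range_linearCombination k] at h
  obtain ⟨v, hv⟩ := h
  exact ⟨v, hv.symm⟩

lemma alternating_of_sum_X_mul_linForm_eq_zero {a : Fin (n + 1) → Fin (n + 1) → k}
    (h : ∑ i, X i * linForm (a i) = 0) : (∀ i j, a i j = -a j i) ∧ ∀ i, a i i = 0 := by
  have key : ∀ x : Fin (n + 1) → k, ∑ i, x i * (a i ⬝ᵥ x) = 0 := fun x => by
    simpa [eval_linForm] using congrArg (eval x) h
  have hs : ∀ i, a i i = 0 := fun i => by
    simpa [Pi.single_apply] using key (Pi.single i 1)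
  refine ⟨fun i j => ?_, hs⟩
  have hij := key (Pi.single i 1 + Pi.single j 1)
  simp only [Pi.add_apply, add_mul, dotProduct_add, Finset.sum_add_distrib] at hij
  simp only [Pi.single_apply, ite_mul, one_mul, zero_mul, Finset.sum_ite_eq', Finset.mem_univ,
    if_true, dotProduct_single, mul_one] at hij
  linear_combination hij - hs i - hs j

/-- The Pfaffian of a skew-symmetric `4 × 4` matrix. -/
def pf {R : Type*} [CommRing R] (a : Fin 4 → Fin 4 → R) : R :=
  a 0 1 * a 2 3 - a 0 2 * a 1 3 + a 0 3 * a 1 2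

/-- A skew-symmetric matrix with a nonzero kernel vector has Pfaffian zero. -/
lemma pf_mul_eq_zero {R : Type*} [CommRing R] {a : Fin 4 → Fin 4 → R} {x : Fin 4 → R}
    (ha : ∀ i j, a i j = -a j i) (ha' : ∀ i, a i i = 0) (h : ∀ i, ∑ j, a i j * x j = 0) :
    pf a * x 3 = 0 := by
  have h0 := h 0
  have h1 := h 1
  have h2 := h 2
  simp only [Fin.sum_univ_four, ha', ha 1 0, ha 2 0, ha 2 1] at h0 h1 h2
  rw [pf]
  linear_combination a 0 1 * h2 - a 0 2 * h1 + a 1 2 * h0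

/-- A linear space of skew-symmetric `4 × 4` matrices of rank at most two has dimension at most
three: it is totally isotropic for the nondegenerate Pfaffian form on a six-dimensional space. -/
lemma exists_sum_smul_eq_zero_of_pf_eq_zero {a : Fin 4 → Fin 4 → Fin 4 → k}
    (ha : ∀ r i j, a r i j = -a r j i) (ha' : ∀ r i, a r i i = 0)
    (h : ∀ t : Fin 4 → k, pf (fun i j => ∑ r, t r * a r i j) = 0) :
    ∃ t : Fin 4 → k, t ≠ 0 ∧ ∀ i j, ∑ r, t r * a r i j = 0 := by
  by_contra! hcon
  let M : Fin 4 → Fin 6 → k :=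
    fun r => ![a r 0 1, a r 0 2, a r 0 3, a r 1 2, a r 1 3, a r 2 3]
  have hM : LinearIndependent k M := by
    rw [Fintype.linearIndependent_iff]
    intro t ht
    by_contra! ht0
    obtain ⟨i, j, hij⟩ := hcon t fun h0 => ht0.elim fun i hi => hi (congrFun h0 i)
    apply hij
    have e : ∀ m, ∑ r, t r * M r m = 0 := fun m => by simpa using congrFun ht m
    have e0 : ∑ r, t r * a r 0 1 = 0 := e 0
    have e1 : ∑ r, t r * a r 0 2 = 0 := e 1
    have e2 : ∑ r, t r * a r 0 3 = 0 := e 2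
    have e3 : ∑ r, t r * a r 1 2 = 0 := e 3
    have e4 : ∑ r, t r * a r 1 3 = 0 := e 4
    have e5 : ∑ r, t r * a r 2 3 = 0 := e 5
    have hs : ∑ r, t r * a r i j = -∑ r, t r * a r j i := by
      rw [← Finset.sum_neg_distrib]
      exact Finset.sum_congr rfl fun r _ => by rw [ha r i j]; ring
    fin_cases i <;> fin_cases j <;> first
      | exact Finset.sum_eq_zero fun r _ => by rw [ha' r]; exact mul_zero _
      | assumption
      | exact hs.trans (neg_eq_zero.2 (by assumption))
  have hrank : (Matrix.of M).rank = 4 := by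
    simpa using LinearIndependent.rank_matrix (M := Matrix.of M) hM
  -- the Gram matrix of the Pfaffian form
  let Q : Matrix (Fin 6) (Fin 6) k :=
    !![0, 0, 0, 0, 0, 1; 0, 0, 0, 0, -1, 0; 0, 0, 0, 1, 0, 0;
       0, 0, 1, 0, 0, 0; 0, -1, 0, 0, 0, 0; 1, 0, 0, 0, 0, 0]
  have hQ : Q * Q = 1 := by
    ext i j
    fin_cases i <;> fin_cases j <;> simp [Q, Matrix.mul_apply, Fin.sum_univ_six]
  have hpolar : ∀ r s, a r 0 1 * a s 2 3 - a r 0 2 * a s 1 3 + a r 0 3 * a s 1 2 +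
      a r 1 2 * a s 0 3 - a r 1 3 * a s 0 2 + a r 2 3 * a s 0 1 = 0 := by
    intro r s
    have h1 := h (Pi.single r 1)
    have h2 := h (Pi.single s 1)
    have h3 := h (Pi.single r 1 + Pi.single s 1)
    simp only [pf, Pi.add_apply, add_mul, Finset.sum_add_distrib] at h1 h2 h3
    simp only [Pi.single_apply, ite_mul, one_mul, zero_mul, Finset.sum_ite_eq', Finset.mem_univ,
      if_true] at h1 h2 h3
    linear_combination h3 - h1 - h2
  have hmul : Matrix.of M * (Q * (Matrix.of M).transpose) = 0 := by
    ext r s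
    have : ∀ m, (Q * (Matrix.of M).transpose) m s =
        ![a s 2 3, -a s 1 3, a s 1 2, a s 0 3, -a s 0 2, a s 0 1] m := by
      intro m
      fin_cases m <;> simp [Q, M, Matrix.mul_apply, Fin.sum_univ_six]
    rw [Matrix.mul_apply]
    simp only [this, Fin.sum_univ_six, Matrix.zero_apply]
    rw [← hpolar r s]
    simp [M]
    ring
  have h1 := Matrix.rank_add_rank_le_card_of_mul_eq_zero hmul
  rw [Matrix.rank_mul_eq_right_of_isUnit_det _ _ (Matrix.isUnit_det_of_left_inverse hQ),
    Matrix.rank_transpose, hrank] at h1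
  simp at h1

/-- If a skew-symmetric matrix of combinations of the forms of `G` kills the vector of variables
and the last unit vector, then it is the matrix of the cross product with `(g x₀, g x₁, g x₂)` for
some form `g`. -/
lemma isConeType_of_skew_last {G : RatMap k 3} (hG : Function.Injective G.comb)
    {a : Fin 4 → Fin 4 → Fin 4 → k} (ha : ∀ r i j, a r i j = -a r j i) (ha' : ∀ r i, a r i i = 0)
    (ha3 : ∀ r i, a r i 3 = 0) (ha0 : ∃ r i j, a r i j ≠ 0)
    (h : ∀ i, ∑ l, G.comb (fun r => a r i l) * X l = 0) : G.IsConeType := by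
  let V : Fin 4 → Fin 4 → CoordRing k 3 := fun i j => G.comb (fun r => a r i j)
  have hV : ∀ i j, V i j = -V j i := fun i j => by
    simp only [V]
    rw [← map_neg]
    exact congrArg _ (funext fun r => ha r i j)
  have hVd : ∀ i, V i i = 0 := fun i => by
    simp only [V, ha']
    exact map_zero _
  have hV3 : ∀ i, V i 3 = 0 := fun i => by
    simp only [V, ha3]
    exact map_zero _
  have h0 : V 0 1 * X 1 + V 0 2 * X 2 = 0 := by
    have := h 0
    change ∑ l, V 0 l * X l = 0 at this
    simpa [Fin.sum_univ_four, hVd, hV3] using this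
  have h1 : V 1 0 * X 0 + V 1 2 * X 2 = 0 := by
    have := h 1
    change ∑ l, V 1 l * X l = 0 at this
    simpa [Fin.sum_univ_four, hVd, hV3] using this
  have h2 : V 2 0 * X 0 + V 2 1 * X 1 = 0 := by
    have := h 2
    change ∑ l, V 2 l * X l = 0 at this
    simpa [Fin.sum_univ_four, hVd, hV3] using this
  let v : Fin 3 → Fin 4 → k := ![fun r => a r 1 2, fun r => a r 2 0, fun r => a r 0 1]
  obtain ⟨g, hg⟩ := exists_eq_mul_X (a := fun i => G.comb (v i)) (Fin.castSucc_injective 3)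
    (fun i => by
      have e0 : X 0 * V 2 0 = X 1 * V 1 2 := by linear_combination h2 - X 1 * hV 2 1
      have e1 : X 0 * V 0 1 = X 2 * V 1 2 := by linear_combination -h1 + X 0 * hV 0 1
      fin_cases i
      · rfl
      · exact e0
      · exact e1)
  have hg0 : g ≠ 0 := by
    rintro rfl
    simp only [zero_mul] at hg
    have hz : ∀ i r, v i r = 0 := fun i r =>
      congrFun (hG ((hg i).trans (map_zero _).symm)) r
    have z0 : ∀ r, a r 1 2 = 0 := hz 0
    have z1 : ∀ r, a r 2 0 = 0 := hz 1
    have z2 : ∀ r, a r 0 1 = 0 := hz 2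
    obtain ⟨r, i, j, hr⟩ := ha0
    apply hr
    fin_cases i <;> fin_cases j <;> first
      | exact ha' r _ | exact ha3 r _ | exact z0 r | exact z1 r | exact z2 r
      | exact (ha r _ _).trans (neg_eq_zero.2 (ha3 r _))
      | exact (ha r _ _).trans (neg_eq_zero.2 (z0 r))
      | exact (ha r _ _).trans (neg_eq_zero.2 (z1 r))
      | exact (ha r _ _).trans (neg_eq_zero.2 (z2 r))
  have hvi : LinearIndependent k v := by
    rw [Fintype.linearIndependent_iff]
    intro c hc i
    have h1 := congrArg G.comb hc
    simp only [map_sum, map_smul, hg, map_zero, ← mul_smul_comm] at h1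
    rw [← Finset.mul_sum, mul_eq_zero, or_iff_right hg0] at h1
    have h2 := congrArg (eval (Pi.single i.castSucc 1)) h1
    simpa [smul_eval, Pi.single_apply] using h2
  obtain ⟨M, hM⟩ := exists_gl_row_castLE (n := 3) (by omega) _ hvi
  refine ⟨M, 1, g, fun i => ?_⟩
  rw [← hg i, RatMap.conj_form, Units.val_one, subst_one]
  exact congrArg G.comb (hM i)

/-- The general case of `isConeType_of_skew_last`: a change of coordinates makes the constant kernel
vector the last unit vector. -/
lemma isConeType_of_skew {G : RatMap k 3} (hG : Function.Injective G.comb)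
    {a : Fin 4 → Matrix (Fin 4) (Fin 4) k} (ha : ∀ r i j, a r i j = -a r j i)
    (ha' : ∀ r i, a r i i = 0)
    (ha0 : ∃ r i j, a r i j ≠ 0) {v : Fin 4 → k} (hv : v ≠ 0) (hav : ∀ r, (a r).mulVec v = 0)
    (h : ∀ i, ∑ l, G.comb (fun r => a r i l) * X l = 0) : G.IsConeType := by
  obtain ⟨T, hT⟩ := exists_gl_mulVec_last hv
  let b : Fin 4 → Matrix (Fin 4) (Fin 4) k := fun r => T.1.transpose * (a r * T.1)
  have hb : ∀ r i j, b r i j = ∑ i', ∑ l', T.1 i' i * T.1 l' j * a r i' l' := fun r i j => by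
    simp only [b, Matrix.mul_apply, Matrix.transpose_apply, Finset.mul_sum]
    exact Finset.sum_congr rfl fun _ _ => Finset.sum_congr rfl fun _ _ => by ring
  have hskew : ∀ r i j, b r i j = -b r j i := fun r i j => by
    rw [hb, hb, Finset.sum_comm, ← Finset.sum_neg_distrib]
    refine Finset.sum_congr rfl fun x _ => ?_
    rw [← Finset.sum_neg_distrib]
    exact Finset.sum_congr rfl fun y _ => by rw [ha r y x]; ring
  have hdiag : ∀ r i, b r i i = 0 := fun r i => by
    have : ∀ w : Fin 4 → k, ∑ x, ∑ y, w x * w y * a r x y = 0 := fun w => by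
      simp only [Fin.sum_univ_four, ha']
      linear_combination w 0 * w 1 * ha r 0 1 + w 0 * w 2 * ha r 0 2 + w 0 * w 3 * ha r 0 3 +
        w 1 * w 2 * ha r 1 2 + w 1 * w 3 * ha r 1 3 + w 2 * w 3 * ha r 2 3
    rw [hb]
    exact this fun x => T.1 x i
  have hlast : ∀ r i, b r i 3 = 0 := fun r i => by
    have h1 : (b r).mulVec (Pi.single (Fin.last 3) 1) = 0 := by
      simp only [b]
      rw [← Matrix.mulVec_mulVec, ← Matrix.mulVec_mulVec, hT, hav, Matrix.mulVec_zero]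
    rw [Matrix.mulVec_single_one] at h1
    exact congrFun h1 i
  have hne : ∃ r i j, b r i j ≠ 0 := by
    by_contra! h0
    obtain ⟨r, i, j, hr⟩ := ha0
    apply hr
    have hb0 : b r = 0 := by ext i j; exact h0 r i j
    have : a r = (T⁻¹).1.transpose * b r * (T⁻¹).1 := by
      simp only [b]
      have e1 : (T⁻¹).1.transpose * T.1.transpose = 1 := by
        rw [← Matrix.transpose_mul, ← Units.val_mul, mul_inv_cancel, Units.val_one,
          Matrix.transpose_one]
      have e2 : T.1 * (T⁻¹).1 = 1 := by rw [← Units.val_mul, mul_inv_cancel, Units.val_one]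
      rw [← Matrix.mul_assoc, e1, Matrix.one_mul, Matrix.mul_assoc, e2, Matrix.mul_one]
    rw [this, hb0]
    simp
  have hcomb : ∀ w, (G.conj 1 T).comb w = subst T.1 (G.comb w) := fun w => by
    rw [RatMap.conj_comb, Units.val_one, Matrix.vecMul_one]
  have hcone : (G.conj 1 T).IsConeType := by
    refine isConeType_of_skew_last (a := b) ?_ hskew hdiag hlast hne fun i => ?_
    · intro v w hvw
      rw [hcomb, hcomb] at hvw
      have := congrArg (subst (T⁻¹).1) hvw
      rw [subst_inv_subst, subst_inv_subst] at this
      exact hG this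
    · have h1 : ∀ l, (fun r => b r i l) =
          ∑ i', ∑ l', (T.1 i' i * T.1 l' l) • fun r => a r i' l' := by
        intro l
        ext r
        rw [hb]
        simp [Finset.sum_apply]
      have h2 : ∀ l', ∑ l, T.1 l' l • X l = subst T.1 (X l' : CoordRing k 3) := fun l' => by
        rw [subst_X, linForm_apply]
        simp only [smul_eq_C_mul]
      calc ∑ l, (G.conj 1 T).comb (fun r => b r i l) * X l
          = ∑ i', T.1 i' i • ∑ l', subst T.1 (G.comb fun r => a r i' l') * ∑ l, T.1 l' l • X l := by
            simp only [h1, hcomb, map_sum, map_smul, Finset.sum_mul, Finset.mul_sum,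
              Finset.smul_sum]
            rw [Finset.sum_comm]
            refine Finset.sum_congr rfl fun i' _ => ?_
            rw [Finset.sum_comm]
            refine Finset.sum_congr rfl fun l' _ => Finset.sum_congr rfl fun l _ => ?_
            rw [smul_mul_assoc, mul_smul_comm, smul_smul]
        _ = 0 := by
            simp only [h2, ← map_mul, ← map_sum, h, map_zero, smul_zero, Finset.sum_const_zero]
  exact (G.linearlyEquivalent_conj 1 T).isConeType hcone

/-! ### From the resolution to the cone type -/

lemma apply_mem_of_mem_smul_top {ι R : Type*} [CommRing R] {I : Ideal R} {v : ι → R}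
    (hv : v ∈ I • (⊤ : Submodule R (ι → R))) (i : ι) : v i ∈ I := by
  have h := Submodule.mem_map_of_mem (f := LinearMap.proj (R := R) (φ := fun _ : ι => R) i) hv
  rw [Submodule.map_smul''] at h
  exact Submodule.smul_le.2 (fun r hr x _ => I.mul_mem_right x hr) h

lemma eq_zero_of_C_mem_irrelevantIdeal {c : k} (h : C c ∈ irrelevantIdeal k n) : c = 0 := by
  rw [irrelevantIdeal, ← Set.image_univ, ← ker_killVars, RingHom.mem_ker, algHom_C] at h
  exact C_injective _ _ (h.trans C_0.symm)

lemma single_mem_twistedPart {ι : Type*} [DecidableEq ι] (a : ι → ℕ) (i : ι) :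
    (Pi.single i 1 : ι → CoordRing k n) ∈ twistedPart (k := k) a (a i) := by
  rw [mem_twistedPart]
  intro j
  rcases eq_or_ne j i with rfl | h
  · exact Or.inr ⟨le_rfl, by simpa using isHomogeneous_one _ _⟩
  · exact Or.inl (by simp [h])

/-- Forms `p r` of degree `d` that generate the base ideal of a Cremona map of degree `d` form
a basis of its linear system. -/
lemma exists_conj_form_eq {F : RatMap k 3} (hF : F.IsCremona) {p : Fin 4 → CoordRing k 3}
    (hp : ∀ r, (p r).IsHomogeneous F.degree) (hmem : ∀ i, F.form i ∈ Ideal.span (Set.range p)) :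
    ∃ N : GL (Fin 4) k, (F.conj N 1).form = p := by
  have h1 : ∀ j, ∃ N : Fin 4 → k, F.form j = ∑ r, N r • p r := by
    intro j
    obtain ⟨v, hv⟩ := Ideal.mem_span_range_iff_exists_fun.1 (hmem j)
    refine ⟨fun r => coeff 0 (v r), ?_⟩
    have h1 := congrArg (homogeneousComponent (0 + F.degree)) hv
    rw [zero_add, homogeneousComponent_eq_self (F.isHomogeneous j), map_sum] at h1
    rw [← h1]
    refine Finset.sum_congr rfl fun r _ => ?_
    have h2 := homogeneousComponent_mul_of_isHomogeneous (hp r) (v r) 0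
    rw [zero_add] at h2
    rw [h2, homogeneousComponent_zero, smul_eq_C_mul]
  choose N hN using h1
  have hunit : IsUnit (Matrix.of N) := by
    rw [← Matrix.linearIndependent_rows_iff_isUnit, Fintype.linearIndependent_iff]
    intro t ht
    have h2 : F.comb t = 0 := by
      rw [RatMap.comb_apply]
      simp only [hN, ← smul_eq_C_mul, Finset.smul_sum, smul_smul]
      rw [Finset.sum_comm]
      refine Finset.sum_eq_zero fun r _ => ?_
      rw [← Finset.sum_smul]
      have := congrFun ht r
      simp only [Finset.sum_apply, Pi.smul_apply, smul_eq_mul] at this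
      rw [show ∑ i, t i * N i r = 0 from this, zero_smul]
    exact fun i => congrFun (hF.comb_injective (h2.trans (map_zero _).symm)) i
  refine ⟨hunit.unit⁻¹, funext fun r => ?_⟩
  rw [RatMap.conj_form, Units.val_one, subst_one, RatMap.comb_apply]
  simp only [hN, ← smul_eq_C_mul, Finset.smul_sum, smul_smul]
  rw [Finset.sum_comm]
  simp only [← Finset.sum_smul]
  have h3 : (hunit.unit⁻¹).1 * Matrix.of N = 1 := by
    have := hunit.unit.inv_mul
    exact this
  have h4 : ∀ s, ∑ i, (hunit.unit⁻¹).1 r i * N i s = if r = s then 1 else 0 := fun s => by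
    rw [← Matrix.one_apply, ← h3, Matrix.mul_apply]
    rfl
  simp only [h4, ite_smul, one_smul, zero_smul, Finset.sum_ite_eq, Finset.mem_univ, if_true]

/-- The part of the minimal resolution that matters: the relations between the forms, the
relation `q` between the relations, whose entries are linear forms, and which involves linear
relations only. -/
lemma exists_linear_syzygies {F : RatMap k 3} (hF : F.IsCremona) {d : ℕ} (hd : 2 ≤ d)
    (hFd : F.degree = d)
    (h : HasMinimalGradedFreeResolution F.baseIdeal
      (fun _ : Fin 4 => d) ![d + 1, d + 1, d + 1, 2 * d - 1] (fun _ : Fin 1 => d + 2)) :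
    ∃ (N : GL (Fin 4) k) (c : Fin 4 → Fin 4 → CoordRing k 3) (q : Fin 4 → CoordRing k 3),
      (∀ j, (q j).IsHomogeneous 1) ∧ (∀ j, q j = 0 ∨ ∀ r, (c j r).IsHomogeneous 1) ∧
      (∃ j, q j ≠ 0) ∧ (∀ r, ∑ j, q j * c j r = 0) ∧
      (∀ j, ∑ r, c j r * (F.conj N 1).form r = 0) ∧
      (∀ t : Fin 4 → k, (∀ r, ∑ j, t j • c j r = 0) → t = 0) ∧
      (∀ v : Fin 4 → CoordRing k 3, ∑ r, v r * (F.conj N 1).form r = 0 →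
        ∃ w : Fin 4 → CoordRing k 3, ∀ r, v r = ∑ j, w j * c j r) := by
  obtain ⟨π, φ, ψ, hπ, hφ, hψ, hinj, hex1, hex2, hex3, -, -, hmin⟩ := h
  have hπv : ∀ v, π v = ∑ r, v r * π (Pi.single r 1) := fun v => by
    conv_lhs => rw [pi_eq_sum_univ' v]
    simp
  have hφv : ∀ v, φ v = ∑ j, v j • φ (Pi.single j 1) := fun v => by
    conv_lhs => rw [pi_eq_sum_univ' v]
    simp
  have hp : ∀ r, (π (Pi.single r 1)).IsHomogeneous F.degree := fun r => by
    rw [hFd]; exact hπ d _ (single_mem_twistedPart (fun _ : Fin 4 => d) r)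
  obtain ⟨N, hN⟩ := exists_conj_form_eq hF hp fun i => by
    have h1 : F.form i ∈ LinearMap.ker (Submodule.mkQ F.baseIdeal) := by
      rw [Submodule.ker_mkQ]; exact Ideal.subset_span ⟨i, rfl⟩
    rw [LinearMap.exact_iff.1 hex3] at h1
    obtain ⟨v, hv⟩ := h1
    rw [← hv, hπv]
    exact Ideal.sum_mem _ fun r _ => Ideal.mul_mem_left _ _ (Ideal.subset_span ⟨r, rfl⟩)
  have hψI : ∀ s j, ψ s j ∈ irrelevantIdeal k 3 := fun s j =>
    apply_mem_of_mem_smul_top (hmin ⟨s, rfl⟩) j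
  have hq := mem_twistedPart.1 (hψ (d + 2) _ (single_mem_twistedPart (fun _ : Fin 1 => d + 2) 0))
  have hc := fun j => mem_twistedPart.1
    (hφ _ _ (single_mem_twistedPart ![d + 1, d + 1, d + 1, 2 * d - 1] j))
  have hlin : ∀ j, ψ (Pi.single 0 1) j = 0 ∨
      ![d + 1, d + 1, d + 1, 2 * d - 1] j = d + 1 := by
    intro j
    fin_cases j
    · exact Or.inr rfl
    · exact Or.inr rfl
    · exact Or.inr rfl
    · change _ ∨ 2 * d - 1 = d + 1
      rcases hq 3 with h0 | ⟨h1, h2⟩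
      · exact Or.inl h0
      · change 2 * d - 1 ≤ d + 2 at h1
        change (ψ (Pi.single 0 1) 3).IsHomogeneous (d + 2 - (2 * d - 1)) at h2
        rcases (by omega : d = 2 ∨ d = 3) with rfl | rfl
        · exact Or.inr rfl
        · -- a constant entry vanishes by minimality
          left
          have h3 := totalDegree_eq_zero_iff_eq_C.1
            ((totalDegree_zero_iff_isHomogeneous (p := ψ (Pi.single 0 1) 3)).2 h2)
          have h4 := hψI (Pi.single 0 1) 3
          rw [h3] at h4
          change ψ (Pi.single 0 1) 3 = 0
          rw [h3, eq_zero_of_C_mem_irrelevantIdeal h4, C_0]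
  have hφψ : ∀ s, φ (ψ s) = 0 := fun s => (hex1 _).2 ⟨s, rfl⟩
  refine ⟨N, fun j => φ (Pi.single j 1), ψ (Pi.single 0 1), fun j => ?_, fun j => ?_, ?_,
    fun r => ?_, fun j => ?_, fun t ht => ?_, fun v hv => ?_⟩
  · rcases hlin j with h0 | h1
    · rw [h0]; exact isHomogeneous_zero _ _ _
    · rcases hq j with h0 | ⟨-, h2⟩
      · rw [h0]; exact isHomogeneous_zero _ _ _
      · rw [h1] at h2
        rwa [show d + 2 - (d + 1) = 1 by omega] at h2
  · refine (hlin j).imp_right fun h1 r => ?_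
    change (φ (Pi.single j 1) r).IsHomogeneous 1
    rcases hc j r with h0 | ⟨-, h2⟩
    · rw [h0]; exact isHomogeneous_zero _ _ _
    · rw [h1] at h2
      rwa [show d + 1 - d = 1 by omega] at h2
  · by_contra! h0
    have h1 : ψ (Pi.single 0 1) = ψ 0 := by rw [map_zero]; exact funext h0
    have := congrFun (hinj h1) 0
    simp at this
  · have := congrFun (hφψ (Pi.single 0 1)) r
    rw [hφv] at this
    simpa using this
  · rw [hN, ← hπv]
    exact (hex2 _).2 ⟨_, rfl⟩
  · have h1 : φ (fun j => C (t j)) = 0 := by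
      rw [hφv]
      ext1 r
      simpa [smul_eq_C_mul] using ht r
    obtain ⟨s, hs⟩ := (hex1 _).1 h1
    ext j
    refine eq_zero_of_C_mem_irrelevantIdeal (n := 3) ?_
    rw [← congrFun hs j]
    exact hψI s j
  · rw [hN, ← hπv] at hv
    obtain ⟨w, rfl⟩ := (hex2 _).1 hv
    exact ⟨w, fun r => by rw [hφv]; simp⟩

/-- In the relation `∑ qⱼ cⱼ = 0` expand `qⱼ` and `cⱼ` in the variables:
the coefficients form a linear system of skew-symmetric matrices. If the `qⱼ` are linearly
dependent, these matrices have a common kernel vector; otherwise they would all be degenerate, and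
there would be too many of them. -/
lemma isConeType_of_linear_syzygies {G : RatMap k 3} (hG : G.IsCremona)
    {c : Fin 4 → Fin 4 → CoordRing k 3} {q : Fin 4 → CoordRing k 3}
    (hq : ∀ j, (q j).IsHomogeneous 1) (hc : ∀ j, q j = 0 ∨ ∀ r, (c j r).IsHomogeneous 1)
    (hq0 : ∃ j, q j ≠ 0) (hqc : ∀ r, ∑ j, q j * c j r = 0)
    (hcG : ∀ j, ∑ r, c j r * G.form r = 0)
    (hcinj : ∀ t : Fin 4 → k, (∀ r, ∑ j, t j • c j r = 0) → t = 0)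
    (hex : ∀ v : Fin 4 → CoordRing k 3, ∑ r, v r * G.form r = 0 →
        ∃ w : Fin 4 → CoordRing k 3, ∀ r, v r = ∑ j, w j * c j r) : G.IsConeType := by
  choose Q hQ using fun j => exists_eq_linForm (hq j)
  have hQ0 : ∀ j, q j = 0 → Q j = 0 := fun j hj =>
    linForm_injective ((hQ j).symm.trans (hj.trans (map_zero _).symm))
  have hlin : ∀ r i, (∑ j, Q j i • c j r).IsHomogeneous 1 := fun r i =>
    IsHomogeneous.sum _ _ _ fun j _ => by
      rcases hc j with h | h
      · simpa [hQ0 j h] using isHomogeneous_zero _ _ _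
      · rw [smul_eq_C_mul]; exact (h r).C_mul _
  choose a ha using fun r i => exists_eq_linForm (hlin r i)
  have halt := fun r => alternating_of_sum_X_mul_linForm_eq_zero (a := a r) (by
    simp only [← ha, ← hqc r, hQ, linForm_apply, Finset.mul_sum, Finset.sum_mul]
    rw [Finset.sum_comm]
    exact Finset.sum_congr rfl fun j _ => Finset.sum_congr rfl fun i _ => by
      rw [smul_eq_C_mul]; ring)
  have hskew := fun r => (halt r).1
  have hdiag := fun r => (halt r).2
  have hker : ∀ i, ∑ l, G.comb (fun r => a r i l) * X l = 0 := fun i => by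
    have h1 : ∑ r, linForm (a r i) * G.form r = 0 := by
      simp only [← ha, Finset.sum_mul, smul_mul_assoc]
      rw [Finset.sum_comm]
      simp only [← Finset.smul_sum, hcG, smul_zero, Finset.sum_const_zero]
    rw [← h1]
    simp only [RatMap.comb_apply, linForm_apply, Finset.sum_mul]
    rw [Finset.sum_comm]
    exact Finset.sum_congr rfl fun _ _ => Finset.sum_congr rfl fun _ _ => by ring
  by_cases hdet : (Matrix.of Q).det = 0
  · obtain ⟨v, hv, hQv⟩ := Matrix.exists_mulVec_eq_zero_iff.2 hdet
    refine isConeType_of_skew hG.comb_injective (a := a) hskew hdiag ?_ hv (fun r => ?_) hker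
    · by_contra! h0
      obtain ⟨j, hj⟩ := hq0
      have h1 : ∀ i, (fun j => Q j i) = 0 := fun i => hcinj _ fun r => by
        rw [ha r i, show a r i = 0 from funext (h0 r i), map_zero]
      exact hj (by rw [hQ j, show Q j = 0 from funext fun i => congrFun (h1 i) j, map_zero])
    · have h1 : ∑ i, v i • a r i = 0 := by
        apply linForm_injective
        rw [map_sum, map_zero]
        simp only [map_smul, ← ha, Finset.smul_sum, smul_smul]
        rw [Finset.sum_comm]
        refine Finset.sum_eq_zero fun j _ => ?_
        rw [← Finset.sum_smul]
        have : ∑ i, Q j i * v i = 0 := congrFun hQv j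
        simp only [mul_comm (v _)]
        rw [this, zero_smul]
      ext l
      have h2 : ∑ i, v i * a r i l = 0 := by simpa using congrFun h1 l
      calc (Matrix.mulVec (a r) v) l = ∑ i, a r l i * v i := rfl
        _ = -∑ i, v i * a r i l := by
          rw [← Finset.sum_neg_distrib]
          exact Finset.sum_congr rfl fun i _ => by rw [hskew r l i]; ring
        _ = 0 := by rw [h2, neg_zero]
  · exfalso
    -- the Pfaffian of the matrix of forms vanishes, hence so does that of the matrix of variables
    have hpf : pf (fun i l => linForm fun r => a r i l) = 0 := by
      obtain ⟨H, hGH, -⟩ := hG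
      refine hGH.eq_zero_of_bind₁_eq_zero (e := 2) ?_ ?_
      · have h2 : ∀ u v : Fin 4 → k, (linForm u * linForm v).IsHomogeneous 2 := fun u v =>
          (linForm_isHomogeneous u).mul (linForm_isHomogeneous v)
        exact ((h2 _ _).sub (h2 _ _)).add (h2 _ _)
      · have h3 := pf_mul_eq_zero (a := fun i l => G.comb fun r => a r i l) (x := X)
          (fun i l => by
            rw [← map_neg]
            exact congrArg _ (funext fun r => hskew r i l))
          (fun i => by simp only [hdiag]; exact map_zero _) hker
        have h4 := (mul_eq_zero.1 h3).resolve_right (X_ne_zero _)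
        simpa only [pf, map_add, map_sub, map_mul, RatMap.bind₁_linForm] using h4
    obtain ⟨t, ht, hta⟩ := exists_sum_smul_eq_zero_of_pf_eq_zero hskew hdiag fun t => by
      have := congrArg (eval t) hpf
      simp only [pf, map_add, map_sub, map_mul, eval_linForm, map_zero] at this
      simpa only [pf, dotProduct, mul_comm (t _)] using this
    -- all relations have values in a hyperplane with constant coefficients
    have h1 : (fun j => ∑ r, t r • c j r) = 0 := by
      have hdet' : ((Matrix.of Q).map (C : k →+* CoordRing k 3)).det ≠ 0 := by
        rw [← RingHom.mapMatrix_apply, ← RingHom.map_det]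
        exact fun h => hdet (C_injective _ _ (h.trans C_0.symm))
      refine Matrix.eq_zero_of_vecMul_eq_zero hdet' ?_
      ext1 i
      have h2 : ∑ r, t r • ∑ j, Q j i • c j r = 0 := by
        simp only [ha, ← map_smul]
        rw [← map_sum]
        rw [show ∑ r, t r • a r i = 0 from funext fun l => by simpa using hta i l, map_zero]
      rw [Pi.zero_apply, ← h2]
      simp only [Matrix.vecMul, dotProduct, Matrix.map_apply, Matrix.of_apply, Finset.sum_mul,
        Finset.smul_sum]
      rw [Finset.sum_comm]
      exact Finset.sum_congr rfl fun r _ => Finset.sum_congr rfl fun j _ => by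
        simp only [smul_eq_C_mul]; ring
    -- this contradicts the Koszul relations
    have h2 : ∀ v : Fin 4 → CoordRing k 3, ∑ r, v r * G.form r = 0 → ∑ r, t r • v r = 0 := by
      intro v hv
      obtain ⟨w, hw⟩ := hex v hv
      simp only [hw, Finset.smul_sum]
      rw [Finset.sum_comm]
      refine Finset.sum_eq_zero fun j _ => ?_
      simp only [← mul_smul_comm]
      rw [← Finset.mul_sum, show ∑ r, t r • c j r = 0 from congrFun h1 j, mul_zero]
    have h3 : ∀ r s, t s • G.form r = t r • G.form s := by
      intro r s
      have := h2 (Pi.single s (G.form r) - Pi.single r (G.form s)) (by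
        simp [sub_mul, Pi.single_apply, mul_comm])
      simpa [smul_sub, Pi.single_apply, sub_eq_zero] using this
    obtain ⟨s, hs⟩ : ∃ s, t s ≠ 0 := by
      by_contra! h0; exact ht (funext h0)
    obtain ⟨r, hr⟩ : ∃ r : Fin 4, r ≠ s := exists_ne s
    have h4 : G.comb (Pi.single r (t s)) = G.comb (Pi.single s (t r)) := by
      simpa [RatMap.comb] using h3 r s
    have h5 := congrFun (hG.comb_injective h4) r
    rw [Pi.single_eq_same, Pi.single_eq_of_ne hr] at h5
    exact hs h5

lemma RatMap.isConeType_of_hasMinimalGradedFreeResolution {F : RatMap k 3} (hF : F.IsCremona)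
    {d : ℕ} (hd : 2 ≤ d) (hFd : F.degree = d)
    (h : HasMinimalGradedFreeResolution F.baseIdeal
      (fun _ : Fin 4 => d) ![d + 1, d + 1, d + 1, 2 * d - 1] (fun _ : Fin 1 => d + 2)) :
    F.IsConeType := by
  obtain ⟨N, c, q, hq, hc, hq0, hqc, hcG, hcinj, hex⟩ := exists_linear_syzygies hF hd hFd h
  exact (F.linearlyEquivalent_conj N 1).isConeType
    (isConeType_of_linear_syzygies (hF.conj N 1) hq hc hq0 hqc hcG hcinj hex)

end CremonaMaps

theorem mainTheorem5 {k : Type*} [Field k] [IsAlgClosed k] [CharZero k]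
    (o : CremonaMaps.ProjSpace k 3) (d : ℕ) (hd : 2 ≤ d)
    (F : CremonaMaps.RatMap k 3) (hF : F.IsCremona) (hFd : F.degree = d) :
    (∃ G ∈ CremonaMaps.deJonquieres o 2, F.LinearlyEquivalent G) ↔
      (CremonaMaps.HasMinimalGradedFreeResolution F.baseIdeal
          (fun _ : Fin 4 => d) ![d + 1, d + 1, d + 1, 2 * d - 1] (fun _ : Fin 1 => d + 2) ∧
        (d = 2 → ¬ CremonaMaps.IsUnmixed F.baseIdeal)) := by
  have : Infinite k := IsAlgClosed.instInfinite
  constructor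
  · rintro ⟨G, hG, hFG⟩
    obtain ⟨B, g, f, hg0, hg, hf, hrel, hJ⟩ :=
      (hFG.isConeType (CremonaMaps.isConeType_of_mem_deJonquieres hG)).exists_span_coneGens hF
        (hFd ▸ hd)
    rw [hFd] at hg hf
    rw [hJ]
    exact ⟨CremonaMaps.hasMinimalGradedFreeResolution_span_coneGens hd hg0 hg hf hrel,
      fun _ => CremonaMaps.not_isUnmixed_span_coneGens hd hg0 hg hrel⟩
  · rintro ⟨h, -⟩
    exact (CremonaMaps.RatMap.isConeType_of_hasMinimalGradedFreeResolution hF hd hFd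
      h).exists_mem_deJonquieres hF o
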